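/- Let $d\ge 1$, $\alpha=(\alpha_1,\dots,\alpha_d)\in(-\tfrac12,\infty)^d$ and $0<\lambda<\beta<1$. Let $$d\mu_\alpha(x)=\prod_{i=1}^d \frac{x_i^{\alpha_i}e^{-x_i}}{\Gamma(\alpha_i+1)}\,dx$$ be the Laguerre measure on $(0,\infty)^d$. For $k\in\mathbb N^d$ put $|k|=k_1+\dots+k_d$ and let $L^\alpha_k(x)=\prod_{i} L^{\alpha_i}_{k_i}(x_i)$ be the Laguerre polynomials; they form an orthogonal basis of $L^2(\mu_\alpha)$. Let $\mathcal L_\alpha$ be the self-adjoint operator in $L^2(\mu_\alpha)$ which is the closure of the differential operator $-\sum_{i}\big[x_i\partial_i^2+(\alpha_i+1-x_i)\partial_i\big]$, so that $\mathcal L_\alpha L^\alpha_k=|k|\,L^\alpha_k$. Let $T^\alpha_0f=f$ and, for $t>0$, $T^\alpha_tf(x)=\int G^\alpha_t(x,y)f(y)\,d\mu_\alpha(y)$ be the Laguerre semigroup $e^{-t\mathcal L_\alpha}$, where $$G_t^{\alpha}(x,y)=\prod_{j=1}^d\frac{\Gamma(\alpha_j+1)}{1-e^{-t}}\,e^{-\frac{e^{-t}}{1-e^{-t}}(x_j+y_j)}\Big(\sqrt{e^{-t}x_j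 y_j}\Big)^{-\alpha_j}I_{\alpha_j}\Big(\frac{2\sqrt{e^{-t}x_jy_j}}{1-e^{-t}}\Big)$$ and $I_\nu$ is the modified Bessel function of the first kind, and let $$P^\alpha_tf(x)=\frac1{\sqrt\pi}\int_0^\infty\frac{e^{-u}}{\sqrt u}\,T^\alpha_{t^2/(4u)}f(x)\,du,\qquad t\ge 0,$$ be the Poisson-Laguerre semigroup $e^{-t\sqrt{\mathcal L_\alpha}}$. For $\gamma>0$ let $n$ be the smallest integer greater than $\gamma$. The Laguerre Lipschitz space $Lip_\gamma(\mu_\alpha)$ consists of the (real- or complex-valued) functions $f\in L^\infty(\mu_\alpha)$ for which there is a constant $A\ge 0$ with $$\Big\|\frac{\partial^nP^\alpha_tf}{\partial t^n}\Big\|_\infty\le A\,t^{-n+\gamma}\qquad\text{for all }t>0,$$ and $\|f\|_{Lip_\gamma(\mu_\alpha)}=\|f\|_\infty+A_\gamma(f)$, where $A_\gamma(f)$ is the smallest such $A$. For $f\in Lip_\beta(\mu_\alpha)$ the Laguerre fractional derivative of order $\lambda$ is $$D^\alpha_\lambda f(x)=\frac1{c_\lambda}\int_0^\infty s^{-\lambda-1}\big(P^\alpha_sf(x)-f(x)\big)\,ds,\qquad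 c_\lambda=\int_0^\infty u^{-\lambda-1}(e^{-u}-1)\,du .$$ **Theorem.** For $f\in Lip_\beta(\mu_\alpha)$ the integral defining $D^\alpha_\lambda f(x)$ converges absolutely for almost every $x$, and $D^\alpha_\lambda f=\mathcal L_\alpha^{\lambda/2}f$, that is, $D^\alpha_\lambda f\in L^2(\mu_\alpha)$ and $\int D^\alpha_\lambda f\,L^\alpha_k\,d\mu_\alpha=|k|^{\lambda/2}\int f\,L^\alpha_k\,d\mu_\alpha$ for all $k\in\mathbb N^d$. Moreover $D^\alpha_\lambda$ is bounded from $Lip_\beta(\mu_\alpha)$ to $Lip_{\beta-\lambda}(\mu_\alpha)$: there is a constant $C$, depending only on $d,\alpha,\lambda,\beta$, such that $D^\alpha_\lambda f\in Lip_{\beta-\lambda}(\mu_\alpha)$ and $$\|D^\alpha_\lambda f\|_{Lip_{\beta-\lambda}(\mu_\alpha)}\le C\,\|f\|_{Lip_\beta(\mu_\alpha)}\qquad\text{for all } f\in Lip_\beta(\mu_\alpha).$$ -/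

import Mathlib

open MeasureTheory Set
open scoped ENNReal Nat

noncomputable section

/-- The Laguerre measure `∏ i, x_i ^ α_i * e ^ (-x_i) / Γ(α_i + 1) dx` on `(0, ∞)^d`, seen as a
measure on `ℝ^d` that is carried by the open orthant `(0, ∞)^d`: it is the product of the
one-dimensional measures `x ^ α_i * e ^ (-x) / Γ(α_i + 1) dx` on `(0, ∞)`. -/
def laguerreMeasure {d : ℕ} (α : Fin d → ℝ) : Measure (Fin d → ℝ) :=
  Measure.pi fun i => (volume.restrict (Ioi (0 : ℝ))).withDensity fun x =>
    ENNReal.ofReal (x ^ α i * Real.exp (-x) / Real.Gamma (α i + 1))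

/-- The modified Bessel function of the first kind and order `ν`
(used for `ν > -1` and `z > 0`). -/
def besselModI (ν z : ℝ) : ℝ :=
  ∑' m : ℕ, (z / 2) ^ (2 * (m : ℝ) + ν) / ((m ! : ℝ) * Real.Gamma ((m : ℝ) + ν + 1))

/-- The Laguerre heat kernel `G_t^α(x, y)` with respect to the Laguerre measure
(used for `t > 0` and `x`, `y` in `(0, ∞)^d`). -/
def laguerreHeatKernel {d : ℕ} (α : Fin d → ℝ) (t : ℝ) (x y : Fin d → ℝ) : ℝ :=
  ∏ j, Real.Gamma (α j + 1) / (1 - Real.exp (-t))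
    * Real.exp (-(Real.exp (-t) / (1 - Real.exp (-t))) * (x j + y j))
    * √(Real.exp (-t) * x j * y j) ^ (-α j)
    * besselModI (α j) (2 * √(Real.exp (-t) * x j * y j) / (1 - Real.exp (-t)))

/-- The Laguerre semigroup `T_t^α = e^{-t L_α}`, `t ≥ 0`, with `T_0^α f = f`. -/
def laguerreHeat {𝕜 : Type*} [RCLike 𝕜] {d : ℕ} (α : Fin d → ℝ) (t : ℝ)
    (f : (Fin d → ℝ) → 𝕜) (x : Fin d → ℝ) : 𝕜 :=
  if t = 0 then f x
  else ∫ y, laguerreHeatKernel α t x y • f y ∂(laguerreMeasure α)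

/-- The Poisson-Laguerre semigroup `P_t^α = e^{-t √L_α}`, `t ≥ 0`, obtained from the Laguerre
semigroup by subordination. -/
def laguerrePoisson {𝕜 : Type*} [RCLike 𝕜] {d : ℕ} (α : Fin d → ℝ) (t : ℝ)
    (f : (Fin d → ℝ) → 𝕜) (x : Fin d → ℝ) : 𝕜 :=
  (1 / √Real.pi) •
    ∫ u in Ioi (0 : ℝ), (Real.exp (-u) / √u) • laguerreHeat α (t ^ 2 / (4 * u)) f x

/-- The constants `A ≥ 0` such that `‖∂^n P_t^α f / ∂t^n‖_∞ ≤ A t^{-n+β}` for all `t > 0`, where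
`n` is the smallest integer greater than `β` (for `β > 0`). The derivative in `t` is taken for each
fixed `x`, and `‖·‖_∞` is the essential supremum over `(0, ∞)^d`. -/
def laguerreLipConstants {𝕜 : Type*} [RCLike 𝕜] {d : ℕ} (α : Fin d → ℝ) (β : ℝ)
    (f : (Fin d → ℝ) → 𝕜) : Set ℝ :=
  {A | 0 ≤ A ∧ ∀ t : ℝ, 0 < t →
    eLpNorm (fun x => iteratedDeriv (⌊β⌋₊ + 1) (fun s : ℝ => laguerrePoisson α s f x) t) ∞
        (laguerreMeasure α)
      ≤ ENNReal.ofReal (A * t ^ (-((⌊β⌋₊ + 1 : ℕ) : ℝ) + β))}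

/-- Membership in the Laguerre Lipschitz space `Lip_β(μ_α)`. -/
def MemLaguerreLip {𝕜 : Type*} [RCLike 𝕜] {d : ℕ} (α : Fin d → ℝ) (β : ℝ)
    (f : (Fin d → ℝ) → 𝕜) : Prop :=
  MemLp f ∞ (laguerreMeasure α) ∧ (laguerreLipConstants α β f).Nonempty

/-- The norm `‖f‖_∞ + A_β(f)` of `Lip_β(μ_α)`, with `A_β(f)` the smallest admissible constant. -/
def laguerreLipNorm {𝕜 : Type*} [RCLike 𝕜] {d : ℕ} (α : Fin d → ℝ) (β : ℝ)
    (f : (Fin d → ℝ) → 𝕜) : ℝ :=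
  (eLpNorm f ∞ (laguerreMeasure α)).toReal + sInf (laguerreLipConstants α β f)

/-- The one-dimensional Laguerre polynomial `L_k^a` of degree `k` and type `a > -1`. -/
def laguerrePoly (a : ℝ) (k : ℕ) (x : ℝ) : ℝ :=
  ∑ j ∈ Finset.range (k + 1), (-1) ^ j * Real.Gamma ((k : ℝ) + a + 1)
    / (Real.Gamma ((j : ℝ) + a + 1) * ((k - j)! : ℝ) * (j ! : ℝ)) * x ^ j

/-- The `d`-dimensional Laguerre polynomial `L_k^α`, a tensor product. -/
def laguerrePolyPi {d : ℕ} (α : Fin d → ℝ) (k : Fin d → ℕ) (x : Fin d → ℝ) : ℝ :=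
  ∏ i, laguerrePoly (α i) (k i) (x i)

/-- `g = L_α^{σ} f` in `L²(μ_α)`, where `L_α` is the self-adjoint Laguerre operator, with
eigenfunctions `L_k^α` and eigenvalues `|k| = k_1 + ⋯ + k_d`: both functions are in `L²(μ_α)`, and
the expansion of `g` in the orthogonal basis `(L_k^α)` arises from that of `f` by the multiplier
`|k|^σ`. -/
def IsLaguerrePower {𝕜 : Type*} [RCLike 𝕜] {d : ℕ} (α : Fin d → ℝ) (σ : ℝ)
    (f g : (Fin d → ℝ) → 𝕜) : Prop :=
  MemLp f 2 (laguerreMeasure α) ∧ MemLp g 2 (laguerreMeasure α) ∧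
    ∀ k : Fin d → ℕ,
      ∫ x, laguerrePolyPi α k x • g x ∂(laguerreMeasure α)
        = (((∑ i, k i : ℕ) : ℝ) ^ σ) • ∫ x, laguerrePolyPi α k x • f x ∂(laguerreMeasure α)

/-- The constant `c_λ = ∫_0^∞ u^{-λ-1} (e^{-u} - 1) du`, `0 < λ < 1`. -/
def laguerreFracConst (lam : ℝ) : ℝ :=
  ∫ u in Ioi (0 : ℝ), u ^ (-lam - 1) * (Real.exp (-u) - 1)

/-- The Laguerre fractional derivative
`D_λ^α f = (1 / c_λ) ∫_0^∞ s^{-λ-1} (P_s^α f - f) ds`, `0 < λ < 1`. -/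
def laguerreFracDeriv {𝕜 : Type*} [RCLike 𝕜] {d : ℕ} (α : Fin d → ℝ) (lam : ℝ)
    (f : (Fin d → ℝ) → 𝕜) (x : Fin d → ℝ) : 𝕜 :=
  (1 / laguerreFracConst lam) •
    ∫ s in Ioi (0 : ℝ), s ^ (-lam - 1) • (laguerrePoisson α s f x - f x)

end

/-! The proof works with Laguerre coefficients `∫ f L_k dμ`. The heat kernel is a Poisson mixture of
Gamma densities, so it maps monomials to polynomials explicitly, and it follows that `L_k` is an
eigenfunction with eigenvalue `e^{-|k| t}` (`integral_laguerreKernel_mul_laguerrePoly`). By the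
subordination formula (`integral_poissonDensity_mul_exp`) the Poisson semigroup `P_t` and its time
derivative multiply the `k`-th coefficient by `e^{-t √|k|}` and `-√|k| e^{-t √|k|}`. A bounded function
is determined by its coefficients, because the Laguerre measure has exponential moments
(`ae_eq_of_laguerreCoeff_eq`). Hence every identity between operators that is needed reduces to an
identity between multipliers.

Let `f` be Lipschitz of order `β` with constant `A`, that is, `‖∂_t P_t f‖ ≤ A t^{β-1}`. Integrating
in `t` shows that `P_s f` converges uniformly as `s → 0`. The limit has the coefficients of `f`, so it
is `f`, and `‖P_s f - f‖ ≤ (A / β) s^β` (`norm_poisson_sub_le`). As also `‖P_s f - f‖ ≤ 2 ‖f‖`, the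
integral of `s^{-λ-1} (P_s f - f)` converges absolutely and is bounded, and Fubini's theorem gives
its coefficients (`integral_fracIntegrand`).

For the Lipschitz estimate, `∂_t P_t (D_λ f)` and
`(1 / c_λ) ∫ s^{-λ-1} (∂_t P_{t+s} f - ∂_t P_t f) ds` have the same coefficients. The increment in the
integrand is at most `2 A t^{β-1}`. It equals `(P_{t/2+s} - P_{t/2}) ∂_t P_{t/2} f`, and
`‖∂_t P_t g‖ ≤ 2 ‖g‖ / t` for bounded `g`, so it is also at most a multiple of `A s t^{β-2}`. Using the
second bound for `s ≤ t` and the first one for `s > t`, the integral is at most a multiple of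
`A t^{β-λ-1}` (`norm_poissonDeriv_le_of_laguerreCoeff`). -/

/-! ### The subordination kernel -/

/-- The density `s e^{-s² v} / √(π v)` of the subordination formula in the variable `v = u / s²`,
which turns `P_s f = (1 / √π) ∫ e^{-u} / √u T_{s² / (4u)} f du` into
`P_s f = ∫ poissonDensity s v • T_{1 / (4v)} f dv`. In this form the semigroup does not depend
on `s`. -/
noncomputable def poissonDensity (s v : ℝ) : ℝ :=
  s / √Real.pi * (Real.exp (-(s ^ 2 * v)) / √v)

/-- The derivative of `poissonDensity` with respect to its first variable. -/
noncomputable def poissonDensityDeriv (s v : ℝ) : ℝ :=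
  1 / √Real.pi * ((1 - 2 * s ^ 2 * v) * (Real.exp (-(s ^ 2 * v)) / √v))

lemma measurable_poissonDensity : Measurable (Function.uncurry poissonDensity) := by
  unfold poissonDensity Function.uncurry
  fun_prop

lemma measurable_poissonDensityDeriv : Measurable (Function.uncurry poissonDensityDeriv) := by
  unfold poissonDensityDeriv Function.uncurry
  fun_prop

lemma hasDerivAt_poissonDensity (s v : ℝ) :
    HasDerivAt (fun s => poissonDensity s v) (poissonDensityDeriv s v) s := by
  unfold poissonDensity poissonDensityDeriv
  have h1 : HasDerivAt (fun s : ℝ => -(s ^ 2 * v)) (-(2 * s * v)) s := by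
    refine ((hasDerivAt_pow 2 s).mul_const v).neg.congr_deriv ?_
    norm_num
  have h2 := ((hasDerivAt_id s).div_const (√Real.pi)).mul (h1.exp.div_const (√v))
  refine h2.congr_deriv ?_
  simp only [id]
  ring

lemma integral_exp_neg_div_sqrt {c : ℝ} (hc : 0 < c) :
    ∫ v in Ioi (0 : ℝ), Real.exp (-(c * v)) / √v = √Real.pi / √c := by
  have h := Real.integral_rpow_mul_exp_neg_mul_Ioi (a := 1 / 2) (by norm_num) hc
  rw [Real.Gamma_one_half_eq] at h
  have h2 : (1 / c) ^ (1 / 2 : ℝ) * √Real.pi = √Real.pi / √c := by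
    rw [← Real.sqrt_eq_rpow, Real.sqrt_div zero_le_one, Real.sqrt_one]
    ring
  rw [← h2, ← h]
  refine setIntegral_congr_fun measurableSet_Ioi fun v hv => ?_
  have hv : 0 < v := hv
  have : v ^ ((1 / 2 : ℝ) - 1) = 1 / √v := by
    rw [Real.sqrt_eq_rpow, one_div (v ^ _), ← Real.rpow_neg hv.le]
    norm_num
  simp only [this]
  ring

lemma integral_sqrt_mul_exp_neg {c : ℝ} (hc : 0 < c) :
    ∫ v in Ioi (0 : ℝ), √v * Real.exp (-(c * v)) = √Real.pi / (2 * c * √c) := by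
  have h := Real.integral_rpow_mul_exp_neg_mul_Ioi (a := 3 / 2) (by norm_num) hc
  have hG : Real.Gamma (3 / 2) = √Real.pi / 2 := by
    rw [show (3 / 2 : ℝ) = 1 / 2 + 1 by norm_num, Real.Gamma_add_one (by norm_num),
      Real.Gamma_one_half_eq]
    ring
  rw [hG] at h
  have h2 : (1 / c) ^ (3 / 2 : ℝ) * (√Real.pi / 2) = √Real.pi / (2 * c * √c) := by
    rw [show (3 / 2 : ℝ) = 1 + 1 / 2 by norm_num, Real.rpow_add (by positivity), Real.rpow_one,
      ← Real.sqrt_eq_rpow, Real.sqrt_div zero_le_one, Real.sqrt_one]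
    field_simp
  rw [← h2, ← h]
  refine setIntegral_congr_fun measurableSet_Ioi fun v hv => ?_
  rw [Real.sqrt_eq_rpow]
  norm_num

lemma integrableOn_exp_neg_div_sqrt {c : ℝ} (hc : 0 < c) :
    IntegrableOn (fun v : ℝ => Real.exp (-(c * v)) / √v) (Ioi 0) := by
  -- The Bochner integral of a non-integrable function is `0`, so a nonzero value gives integrability.
  refine Integrable.of_integral_ne_zero ?_
  rw [integral_exp_neg_div_sqrt hc]
  have := Real.pi_pos
  positivity

lemma integrableOn_sqrt_mul_exp_neg {c : ℝ} (hc : 0 < c) :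
    IntegrableOn (fun v : ℝ => √v * Real.exp (-(c * v))) (Ioi 0) := by
  refine Integrable.of_integral_ne_zero ?_
  rw [integral_sqrt_mul_exp_neg hc]
  have := Real.pi_pos
  positivity

lemma poissonDensity_nonneg {s : ℝ} (hs : 0 < s) (v : ℝ) : 0 ≤ poissonDensity s v := by
  unfold poissonDensity; positivity

lemma integrableOn_poissonDensity {s : ℝ} (hs : 0 < s) :
    IntegrableOn (poissonDensity s) (Ioi 0) :=
  (integrableOn_exp_neg_div_sqrt (c := s ^ 2) (by positivity)).const_mul _

lemma integral_poissonDensity {s : ℝ} (hs : 0 < s) :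
    ∫ v in Ioi (0 : ℝ), poissonDensity s v = 1 := by
  unfold poissonDensity
  rw [integral_const_mul, integral_exp_neg_div_sqrt (by positivity), Real.sqrt_sq hs.le]
  have := Real.pi_pos
  field_simp

/-- A majorant of `|poissonDensityDeriv s v|` that is uniform for `l ≤ s ≤ b`. -/
lemma abs_poissonDensityDeriv_le {l b s v : ℝ} (hl : 0 < l) (hls : l ≤ s) (hsb : s ≤ b)
    (hv : 0 < v) :
    |poissonDensityDeriv s v| ≤ 1 / √Real.pi * (Real.exp (-(l ^ 2 * v)) / √v
      + 2 * b ^ 2 * (√v * Real.exp (-(l ^ 2 * v)))) := by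
  have hs : 0 < s := hl.trans_le hls
  unfold poissonDensityDeriv
  rw [abs_mul, abs_of_nonneg (a := 1 / √Real.pi) (by positivity)]
  refine mul_le_mul_of_nonneg_left ?_ (by positivity)
  have hvv : v / √v = √v := Real.div_sqrt
  have he : Real.exp (-(s ^ 2 * v)) ≤ Real.exp (-(l ^ 2 * v)) := by
    apply Real.exp_le_exp.2
    have : l ^ 2 ≤ s ^ 2 := by gcongr
    nlinarith
  rw [abs_mul, abs_of_nonneg (a := Real.exp (-(s ^ 2 * v)) / √v) (by positivity)]
  have h1 : |1 - 2 * s ^ 2 * v| ≤ 1 + 2 * b ^ 2 * v := by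
    have h3 : s ^ 2 * v ≤ b ^ 2 * v := by gcongr
    have h4 : 0 ≤ s ^ 2 * v := by positivity
    rw [abs_le]
    constructor <;> nlinarith
  calc |1 - 2 * s ^ 2 * v| * (Real.exp (-(s ^ 2 * v)) / √v)
      ≤ (1 + 2 * b ^ 2 * v) * (Real.exp (-(l ^ 2 * v)) / √v) := by gcongr
    _ = Real.exp (-(l ^ 2 * v)) / √v + 2 * b ^ 2 * (v / √v * Real.exp (-(l ^ 2 * v))) := by ring
    _ = _ := by rw [hvv]

lemma integrableOn_poissonDensityDeriv {s : ℝ} (hs : 0 < s) :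
    IntegrableOn (poissonDensityDeriv s) (Ioi 0) := by
  refine Integrable.mono' (((integrableOn_exp_neg_div_sqrt (c := s ^ 2) (by positivity)).add
    ((integrableOn_sqrt_mul_exp_neg (c := s ^ 2) (by positivity)).const_mul
      (2 * s ^ 2))).const_mul (1 / √Real.pi))
    (measurable_poissonDensityDeriv.of_uncurry_left.aestronglyMeasurable) ?_
  filter_upwards [ae_restrict_mem measurableSet_Ioi] with v hv
  exact abs_poissonDensityDeriv_le hs le_rfl le_rfl hv

lemma integral_abs_poissonDensityDeriv_le {s : ℝ} (hs : 0 < s) :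
    ∫ v in Ioi (0 : ℝ), |poissonDensityDeriv s v| ≤ 2 / s := by
  have h1 := integrableOn_exp_neg_div_sqrt (c := s ^ 2) (by positivity)
  have h2 := (integrableOn_sqrt_mul_exp_neg (c := s ^ 2) (by positivity)).const_mul (2 * s ^ 2)
  have := setIntegral_mono_on (integrableOn_poissonDensityDeriv hs).abs
    ((h1.add h2).const_mul (1 / √Real.pi)) measurableSet_Ioi
    fun v hv => abs_poissonDensityDeriv_le hs le_rfl le_rfl hv
  refine this.trans_eq ?_
  simp only [Pi.add_apply]
  rw [integral_const_mul, integral_add h1 h2, integral_const_mul,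
    integral_exp_neg_div_sqrt (by positivity), integral_sqrt_mul_exp_neg (by positivity),
    Real.sqrt_sq hs.le]
  have := Real.pi_pos
  field_simp
  norm_num

section Subordination

variable {E : Type*} [NormedAddCommGroup E] [NormedSpace ℝ E]

/-- The subordinated function `s ↦ ∫₀^∞ poissonDensity s v • h v dv`. -/
noncomputable def subordinate (h : ℝ → E) (s : ℝ) : E :=
  ∫ v in Ioi (0 : ℝ), poissonDensity s v • h v

/-- The function `s ↦ ∫₀^∞ ∂_s (poissonDensity s v) • h v dv`; for bounded `h` it is the derivative
of `subordinate h` on `(0, ∞)`. -/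
noncomputable def subordinateDeriv (h : ℝ → E) (s : ℝ) : E :=
  ∫ v in Ioi (0 : ℝ), poissonDensityDeriv s v • h v

variable {h : ℝ → E} {M : ℝ}

lemma norm_subordinate_le (hb : ∀ v, 0 < v → ‖h v‖ ≤ M) {s : ℝ} (hs : 0 < s) :
    ‖subordinate h s‖ ≤ M := by
  refine (norm_integral_le_of_norm_le ((integrableOn_poissonDensity hs).mul_const M) ?_).trans_eq ?_
  · filter_upwards [ae_restrict_mem measurableSet_Ioi] with v hv
    rw [norm_smul, Real.norm_of_nonneg (poissonDensity_nonneg hs v)]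
    exact mul_le_mul_of_nonneg_left (hb v hv) (poissonDensity_nonneg hs v)
  · rw [integral_mul_const, integral_poissonDensity hs, one_mul]

lemma norm_subordinateDeriv_le (hb : ∀ v, 0 < v → ‖h v‖ ≤ M) {s : ℝ} (hs : 0 < s) :
    ‖subordinateDeriv h s‖ ≤ 2 * M / s := by
  have hM : 0 ≤ M := (norm_nonneg _).trans (hb 1 one_pos)
  refine (norm_integral_le_of_norm_le
    ((integrableOn_poissonDensityDeriv hs).abs.mul_const M) ?_).trans ?_
  · filter_upwards [ae_restrict_mem measurableSet_Ioi] with v hv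
    rw [norm_smul, Real.norm_eq_abs]
    exact mul_le_mul_of_nonneg_left (hb v hv) (abs_nonneg _)
  · rw [integral_mul_const]
    calc _ ≤ 2 / s * M :=
          mul_le_mul_of_nonneg_right (integral_abs_poissonDensityDeriv_le hs) hM
      _ = 2 * M / s := by ring

lemma hasDerivAt_subordinate (hm : AEStronglyMeasurable h (volume.restrict (Ioi 0)))
    (hb : ∀ v, 0 < v → ‖h v‖ ≤ M) {s : ℝ} (hs : 0 < s) :
    HasDerivAt (subordinate h) (subordinateDeriv h s) s := by
  have hM : 0 ≤ M := (norm_nonneg _).trans (hb 1 one_pos)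
  have hp : ∀ s, AEStronglyMeasurable (fun v => poissonDensity s v • h v)
      (volume.restrict (Ioi 0)) := fun s =>
    (measurable_poissonDensity.of_uncurry_left.aestronglyMeasurable).smul hm
  have hp' : AEStronglyMeasurable (fun v => poissonDensityDeriv s v • h v)
      (volume.restrict (Ioi 0)) :=
    (measurable_poissonDensityDeriv.of_uncurry_left.aestronglyMeasurable).smul hm
  have hl : 0 < (s / 2) ^ 2 := by positivity
  have hnhds : Icc (s / 2) (2 * s) ∈ nhds s := Icc_mem_nhds (half_lt_self hs) (by linarith)
  refine (hasDerivAt_integral_of_dominated_loc_of_deriv_le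
    (F' := fun s v => poissonDensityDeriv s v • h v) hnhds
    (Filter.Eventually.of_forall hp) ?_ hp' ?_
    ((((integrableOn_exp_neg_div_sqrt hl).add ((integrableOn_sqrt_mul_exp_neg hl).const_mul
      (2 * (2 * s) ^ 2))).const_mul (1 / √Real.pi)).mul_const M) ?_).2
  · refine ((integrableOn_poissonDensity hs).mul_const M).mono' (hp s) ?_
    filter_upwards [ae_restrict_mem measurableSet_Ioi] with v hv
    rw [norm_smul, Real.norm_of_nonneg (poissonDensity_nonneg hs v)]
    exact mul_le_mul_of_nonneg_left (hb v hv) (poissonDensity_nonneg hs v)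
  · filter_upwards [ae_restrict_mem measurableSet_Ioi] with v hv r hr
    rw [norm_smul, Real.norm_eq_abs]
    have := abs_poissonDensityDeriv_le (half_pos hs) hr.1 hr.2 hv
    exact mul_le_mul this (hb v hv) (norm_nonneg _) ((abs_nonneg _).trans this)
  · filter_upwards [] with v r _
    exact (hasDerivAt_poissonDensity r v).smul_const (h v)

lemma norm_subordinate_sub_le (hm : AEStronglyMeasurable h (volume.restrict (Ioi 0)))
    (hb : ∀ v, 0 < v → ‖h v‖ ≤ M) {s t : ℝ} (hs : 0 < s) (hst : s ≤ t) :
    ‖subordinate h t - subordinate h s‖ ≤ 2 * M / s * (t - s) := by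
  have hM : 0 ≤ M := (norm_nonneg _).trans (hb 1 one_pos)
  have := (convex_Icc s t).norm_image_sub_le_of_norm_hasDerivWithin_le
    (f := subordinate h) (f' := subordinateDeriv h) (C := 2 * M / s)
    (fun x hx => (hasDerivAt_subordinate hm hb (hs.trans_le hx.1)).hasDerivWithinAt)
    (fun x hx => (norm_subordinateDeriv_le hb (hs.trans_le hx.1)).trans
      (div_le_div_of_nonneg_left (by positivity) hs hx.1)) (left_mem_Icc.2 hst)
    (right_mem_Icc.2 hst)
  rwa [Real.norm_of_nonneg (sub_nonneg.2 hst)] at this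

/-- A growth bound `‖∂_s u‖ ≤ A s^{β-1}`, known for almost every `s` only, integrates to a Hölder
bound near `0`. -/
lemma norm_subordinate_sub_le_rpow [CompleteSpace E]
    (hm : AEStronglyMeasurable h (volume.restrict (Ioi 0)))
    (hb : ∀ v, 0 < v → ‖h v‖ ≤ M) {A β : ℝ} (hA : 0 ≤ A) (hβ : 0 < β)
    (hd : ∀ᵐ s ∂(volume.restrict (Ioi (0 : ℝ))), ‖subordinateDeriv h s‖ ≤ A * s ^ (β - 1))
    {s t : ℝ} (hs : 0 < s) (hst : s ≤ t) :
    ‖subordinate h t - subordinate h s‖ ≤ A / β * t ^ β := by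
  have hder : ∀ x ∈ uIcc s t, HasDerivAt (subordinate h) (subordinateDeriv h x) x := by
    intro x hx
    rw [uIcc_of_le hst] at hx
    exact hasDerivAt_subordinate hm hb (hs.trans_le hx.1)
  have hd' : ∀ᵐ x ∂(volume.restrict (Ioc s t)), ‖subordinateDeriv h x‖ ≤ A * x ^ (β - 1) :=
    ae_mono (Measure.restrict_mono (fun x hx => hs.trans hx.1) le_rfl) hd
  have hpow : IntervalIntegrable (fun x : ℝ => A * x ^ (β - 1)) volume s t :=
    (intervalIntegral.intervalIntegrable_rpow' (by linarith)).const_mul A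
  have hint : IntervalIntegrable (subordinateDeriv h) volume s t := by
    rw [intervalIntegrable_iff_integrableOn_Ioc_of_le hst] at hpow ⊢
    refine Integrable.mono' hpow ?_ hd'
    refine AEStronglyMeasurable.congr (f := deriv (subordinate h))
      (stronglyMeasurable_deriv _).aestronglyMeasurable ?_
    filter_upwards [ae_restrict_mem measurableSet_Ioc] with x hx
    exact (hasDerivAt_subordinate hm hb (hs.trans hx.1)).deriv
  rw [← intervalIntegral.integral_eq_sub_of_hasDerivAt hder hint]
  have hpw : ∫ x in s..t, A * x ^ (β - 1) = A * ((t ^ β - s ^ β) / β) := by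
    rw [intervalIntegral.integral_const_mul, integral_rpow (Or.inl (by linarith))]
    simp
  calc _ ≤ ∫ x in s..t, A * x ^ (β - 1) := by
        refine intervalIntegral.norm_integral_le_of_norm_le hst ?_ hpow
        exact (ae_restrict_iff' measurableSet_Ioc).1 hd'
    _ = A * ((t ^ β - s ^ β) / β) := hpw
    _ ≤ A * (t ^ β / β) := by
        have : 0 ≤ s ^ β := by positivity
        gcongr
        linarith
    _ = _ := by ring

end Subordination

/-! ### The Laplace transform of the subordination kernel -/

/-- The primitive `z ↦ ∫₀^z e^{-x²} dx` of the Gaussian. -/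
noncomputable def gaussPrimitive (z : ℝ) : ℝ := ∫ x in (0 : ℝ)..z, Real.exp (-x ^ 2)

lemma hasDerivAt_gaussPrimitive (z : ℝ) :
    HasDerivAt gaussPrimitive (Real.exp (-z ^ 2)) z := by
  have hc : Continuous fun x : ℝ => Real.exp (-x ^ 2) := by fun_prop
  exact hc.integral_hasStrictDerivAt 0 z |>.hasDerivAt

lemma gaussPrimitive_neg (z : ℝ) : gaussPrimitive (-z) = -gaussPrimitive z := by
  unfold gaussPrimitive
  have := intervalIntegral.integral_comp_neg (a := 0) (b := -z) fun x : ℝ => Real.exp (-x ^ 2)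
  simp only [neg_neg, neg_zero, neg_sq] at this
  rw [this, intervalIntegral.integral_symm]

lemma tendsto_gaussPrimitive_atTop :
    Filter.Tendsto gaussPrimitive Filter.atTop (nhds (√Real.pi / 2)) := by
  have h := integral_gaussian_Ioi 1
  simp only [neg_mul, one_mul, div_one] at h
  rw [← h]
  refine intervalIntegral_tendsto_integral_Ioi 0 ?_ Filter.tendsto_id
  refine Integrable.of_integral_ne_zero ?_
  rw [h]
  have := Real.pi_pos
  positivity

lemma tendsto_gaussPrimitive_atBot :
    Filter.Tendsto gaussPrimitive Filter.atBot (nhds (-(√Real.pi / 2))) := by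
  have h := (tendsto_gaussPrimitive_atTop.comp Filter.tendsto_neg_atBot_atTop).neg
  refine h.congr fun z => ?_
  simp [gaussPrimitive_neg]

/-- The subordination formula `∫₀^∞ s e^{-s² v} / √(π v) e^{-n / (4v)} dv = e^{-s √n}`. With
`w = s √v` and `b = s √n / 2` the integrand is a multiple of `e^{-w² - b² / w²} dw`, which has the
explicit primitive `(e^{2b} Φ(w + b / w) + e^{-2b} Φ(w - b / w)) / 2`, where `Φ' = e^{-x²}`. -/
lemma integral_poissonDensity_mul_exp {s n : ℝ} (hs : 0 < s) (hn : 0 ≤ n) :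
    ∫ v in Ioi (0 : ℝ), poissonDensity s v * Real.exp (-(n / (4 * v))) = Real.exp (-(s * √n)) := by
  rcases hn.eq_or_lt with rfl | hn
  -- For `n = 0` the term `b / w` vanishes and the limit of the primitive at `0` is a different one.
  · simp [integral_poissonDensity hs]
  set b : ℝ := s * √n / 2 with hbdef
  have hb : 0 < b := by positivity
  have hpi : 0 < √Real.pi := Real.sqrt_pos.2 Real.pi_pos
  have hb2 : b ^ 2 = s ^ 2 * n / 4 := by
    rw [hbdef, div_pow, mul_pow, Real.sq_sqrt hn.le]; norm_num
  set F : ℝ → ℝ := fun v => 1 / √Real.pi *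
    (Real.exp (2 * b) * gaussPrimitive (s * √v + b / (s * √v))
    + Real.exp (-(2 * b)) * gaussPrimitive (s * √v - b / (s * √v))) with hF
  set F' : ℝ → ℝ := fun v => poissonDensity s v * Real.exp (-(n / (4 * v))) with hF'
  have hder : ∀ v ∈ Ioi (0 : ℝ), HasDerivAt F (F' v) v := by
    intro v hv
    have hv : 0 < v := hv
    have hw : 0 < s * √v := by positivity
    have hsq : √v ^ 2 = v := Real.sq_sqrt hv.le
    have h1 : HasDerivAt (fun v => s * √v) (s * (1 / (2 * √v))) v :=
      (Real.hasDerivAt_sqrt hv.ne').const_mul s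
    have h2 : HasDerivAt (fun v => b / (s * √v))
        (-(b * (s * (1 / (2 * √v)))) / (s * √v) ^ 2) v := by
      refine ((hasDerivAt_const v b).div h1 hw.ne').congr_deriv ?_
      ring
    have h3 := (hasDerivAt_gaussPrimitive (s * √v + b / (s * √v))).comp v (h1.add h2)
    have h4 := (hasDerivAt_gaussPrimitive (s * √v - b / (s * √v))).comp v (h1.sub h2)
    refine (((h3.const_mul (Real.exp (2 * b))).add
      (h4.const_mul (Real.exp (-(2 * b))))).const_mul (1 / √Real.pi)).congr_deriv ?_
    have e0 : (s * √v) * (b / (s * √v)) = b := by field_simp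
    have e1 : (s * √v) ^ 2 = s ^ 2 * v := by rw [mul_pow, hsq]
    have e2 : (b / (s * √v)) ^ 2 = n / (4 * v) := by
      rw [div_pow, e1, hb2]; field_simp
    have e3 : Real.exp (2 * b) * Real.exp (-(s * √v + b / (s * √v)) ^ 2)
        = Real.exp (-(s ^ 2 * v)) * Real.exp (-(n / (4 * v))) := by
      rw [← Real.exp_add, ← Real.exp_add]
      congr 1
      linear_combination -e1 - e2 - 2 * e0
    have e4 : Real.exp (-(2 * b)) * Real.exp (-(s * √v - b / (s * √v)) ^ 2)
        = Real.exp (-(s ^ 2 * v)) * Real.exp (-(n / (4 * v))) := by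
      rw [← Real.exp_add, ← Real.exp_add]
      congr 1
      linear_combination -e1 - e2 + 2 * e0
    rw [← mul_assoc (Real.exp (2 * b)), ← mul_assoc (Real.exp (-(2 * b))), e3, e4, hF']
    simp only [poissonDensity]
    ring
  have hpos : ∀ v ∈ Ioi (0 : ℝ), 0 ≤ F' v := fun v hv =>
    mul_nonneg (poissonDensity_nonneg hs v) (Real.exp_pos _).le
  have hint : IntegrableOn F' (Ioi 0) := by
    refine (integrableOn_poissonDensity hs).mono'
      ((measurable_poissonDensity.of_uncurry_left.mul (by fun_prop)).aestronglyMeasurable) ?_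
    filter_upwards [ae_restrict_mem measurableSet_Ioi] with v hv
    have hv : 0 < v := hv
    rw [Real.norm_of_nonneg (hpos v hv)]
    refine mul_le_of_le_one_right (poissonDensity_nonneg hs v) (Real.exp_le_one_iff.2 ?_)
    have : 0 ≤ n / (4 * v) := by positivity
    linarith
  have hw0 : Filter.Tendsto (fun v => s * √v) (nhdsWithin 0 (Ioi 0)) (nhdsWithin 0 (Ioi 0)) := by
    refine tendsto_nhdsWithin_iff.2 ⟨?_, ?_⟩
    · have : Continuous fun v : ℝ => s * √v := by fun_prop
      simpa using (this.tendsto 0).mono_left nhdsWithin_le_nhds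
    · filter_upwards [self_mem_nhdsWithin] with v hv
      have hv : 0 < v := hv
      exact mem_Ioi.2 (by positivity)
  have hw1 : Filter.Tendsto (fun v => s * √v) Filter.atTop Filter.atTop :=
    Real.tendsto_sqrt_atTop.const_mul_atTop hs
  have hq0 : Filter.Tendsto (fun v => b / (s * √v)) (nhdsWithin 0 (Ioi 0)) Filter.atTop :=
    (tendsto_inv_nhdsGT_zero.comp hw0).const_mul_atTop hb
  have hq1 : Filter.Tendsto (fun v => b / (s * √v)) Filter.atTop (nhds 0) :=
    hw1.const_div_atTop b
  have hw0' := hw0.mono_right (nhdsWithin_le_nhds (a := (0 : ℝ)))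
  have h0 : Filter.Tendsto F (nhdsWithin 0 (Ioi 0)) (nhds (1 / √Real.pi *
      (Real.exp (2 * b) * (√Real.pi / 2) + Real.exp (-(2 * b)) * -(√Real.pi / 2)))) := by
    refine (((tendsto_gaussPrimitive_atTop.comp (hw0'.add_atTop hq0)).const_mul _).add
      ((tendsto_gaussPrimitive_atBot.comp ?_).const_mul _)).const_mul _
    simpa [sub_eq_add_neg] using hw0'.add_atBot (Filter.tendsto_neg_atTop_atBot.comp hq0)
  have h1 : Filter.Tendsto F Filter.atTop (nhds (1 / √Real.pi *
      (Real.exp (2 * b) * (√Real.pi / 2) + Real.exp (-(2 * b)) * (√Real.pi / 2)))) := by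
    refine (((tendsto_gaussPrimitive_atTop.comp (hw1.atTop_add hq1)).const_mul _).add
      ((tendsto_gaussPrimitive_atTop.comp ?_).const_mul _)).const_mul _
    simpa [sub_eq_add_neg] using hw1.atTop_add hq1.neg
  have key := integral_Ioi_deriv_mul_eq_sub (a := (0 : ℝ)) (u := F) (u' := F') (v := fun _ => 1)
    (v' := fun _ => 0) hder (fun x _ => hasDerivAt_const x 1)
    (by simpa [Pi.mul_def, Pi.add_def] using hint) (by simpa [Pi.mul_def] using h0)
    (by simpa [Pi.mul_def] using h1)
  simp only [mul_one, mul_zero, add_zero] at key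
  rw [key, show -(s * √n) = -(2 * b) by rw [hbdef]; ring]
  field_simp
  ring

lemma subordinate_exp {n : ℝ} (hn : 0 ≤ n) {s : ℝ} (hs : 0 < s) :
    subordinate (fun v => Real.exp (-(n / (4 * v)))) s = Real.exp (-(s * √n)) :=
  integral_poissonDensity_mul_exp hs hn

lemma subordinateDeriv_exp {n : ℝ} (hn : 0 ≤ n) {s : ℝ} (hs : 0 < s) :
    subordinateDeriv (fun v => Real.exp (-(n / (4 * v)))) s = -√n * Real.exp (-(s * √n)) := by
  have h1 : HasDerivAt (subordinate fun v => Real.exp (-(n / (4 * v))))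
      (subordinateDeriv (fun v => Real.exp (-(n / (4 * v)))) s) s := by
    have hm : Measurable fun v : ℝ => Real.exp (-(n / (4 * v))) := by fun_prop
    refine hasDerivAt_subordinate (M := 1) hm.aestronglyMeasurable (fun v hv => ?_) hs
    rw [Real.norm_of_nonneg (Real.exp_pos _).le, Real.exp_le_one_iff]
    have : 0 ≤ n / (4 * v) := by positivity
    linarith
  have h2 : HasDerivAt (fun s => Real.exp (-(s * √n))) (-√n * Real.exp (-(s * √n))) s := by
    refine ((hasDerivAt_mul_const (√n)).neg.exp).congr_deriv ?_
    simp only [Pi.neg_apply]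
    ring
  refine h1.unique (h2.congr_of_eventuallyEq ?_)
  filter_upwards [Ioi_mem_nhds hs] with r hr
  exact subordinate_exp hn hr

/-! ### The one-dimensional Laguerre measure -/

/-- The one-dimensional Laguerre measure `x ^ α e ^ (-x) / Γ(α + 1) dx` on `(0, ∞)`. -/
noncomputable def laguerreMeasureOne (α : ℝ) : Measure ℝ :=
  (volume.restrict (Ioi (0 : ℝ))).withDensity fun x =>
    ENNReal.ofReal (x ^ α * Real.exp (-x) / Real.Gamma (α + 1))

lemma laguerreMeasure_eq_pi {d : ℕ} (α : Fin d → ℝ) :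
    laguerreMeasure α = Measure.pi fun i => laguerreMeasureOne (α i) := rfl

lemma integral_laguerreMeasureOne {α : ℝ} (hα : -1 < α) (g : ℝ → ℝ) :
    ∫ x, g x ∂(laguerreMeasureOne α)
      = ∫ x in Ioi (0 : ℝ), x ^ α * Real.exp (-x) / Real.Gamma (α + 1) * g x := by
  unfold laguerreMeasureOne
  rw [integral_withDensity_eq_integral_toReal_smul (by fun_prop) (by simp)]
  refine setIntegral_congr_fun measurableSet_Ioi fun x hx => ?_
  have hx : 0 < x := hx
  have hG : 0 < Real.Gamma (α + 1) := Real.Gamma_pos_of_pos (by linarith)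
  simp only [smul_eq_mul]
  rw [ENNReal.toReal_ofReal (by positivity)]

lemma integral_pow_mul_exp_laguerreMeasureOne {α : ℝ} (hα : -1 < α) (j : ℕ) {c : ℝ} (hc : -1 < c) :
    ∫ x, x ^ j * Real.exp (-(c * x)) ∂(laguerreMeasureOne α)
      = (1 / (1 + c)) ^ ((j : ℝ) + α + 1) * Real.Gamma ((j : ℝ) + α + 1) / Real.Gamma (α + 1) := by
  rw [integral_laguerreMeasureOne hα,
    ← Real.integral_rpow_mul_exp_neg_mul_Ioi
      (by have : (0 : ℝ) ≤ j := j.cast_nonneg; linarith) (by linarith), ← integral_div]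
  refine setIntegral_congr_fun measurableSet_Ioi fun x hx => ?_
  have hx : 0 < x := hx
  have h1 : x ^ ((j : ℝ) + α + 1 - 1) = x ^ α * x ^ j := by
    rw [add_sub_cancel_right, add_comm, Real.rpow_add hx, Real.rpow_natCast]
  have h2 : Real.exp (-((1 + c) * x)) = Real.exp (-x) * Real.exp (-(c * x)) := by
    rw [← Real.exp_add]; ring_nf
  simp only [h1, h2]
  ring

lemma integrable_pow_mul_exp_laguerreMeasureOne {α : ℝ} (hα : -1 < α) (j : ℕ) {c : ℝ}
    (hc : -1 < c) : Integrable (fun x => x ^ j * Real.exp (-(c * x))) (laguerreMeasureOne α) := by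
  have hj : (0 : ℝ) ≤ j := j.cast_nonneg
  refine Integrable.of_integral_ne_zero ?_
  rw [integral_pow_mul_exp_laguerreMeasureOne hα j hc]
  have h1 : 0 < Real.Gamma (α + 1) := Real.Gamma_pos_of_pos (by linarith)
  have h2 : 0 < Real.Gamma (j + α + 1) := Real.Gamma_pos_of_pos (by linarith)
  have h3 : 0 < 1 + c := by linarith
  positivity

lemma isProbabilityMeasure_laguerreMeasureOne {α : ℝ} (hα : -1 < α) :
    IsProbabilityMeasure (laguerreMeasureOne α) := by
  have h := integral_pow_mul_exp_laguerreMeasureOne hα 0 (c := 0) (by norm_num)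
  have h1 : 0 < Real.Gamma (α + 1) := Real.Gamma_pos_of_pos (by linarith)
  simp only [pow_zero, zero_mul, neg_zero, Real.exp_zero, mul_one, add_zero, div_one,
    Real.one_rpow, Nat.cast_zero, zero_add, one_mul, integral_const, smul_eq_mul,
    div_self h1.ne'] at h
  refine ⟨?_⟩
  rwa [Measure.real, ENNReal.toReal_eq_one_iff] at h

instance sigmaFinite_laguerreMeasureOne (α : ℝ) : SigmaFinite (laguerreMeasureOne α) := by
  unfold laguerreMeasureOne
  infer_instance

lemma ae_pos_laguerreMeasureOne (α : ℝ) : ∀ᵐ x ∂(laguerreMeasureOne α), 0 < x :=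
  (withDensity_absolutelyContinuous _ _).ae_le (ae_restrict_mem measurableSet_Ioi)

lemma integrable_laguerrePoly {α : ℝ} (hα : -1 < α) (k : ℕ) :
    Integrable (laguerrePoly α k) (laguerreMeasureOne α) := by
  unfold laguerrePoly
  refine integrable_finsetSum _ fun j _ => Integrable.const_mul ?_ _
  simpa using integrable_pow_mul_exp_laguerreMeasureOne hα j (c := 0) (by norm_num)

/-! ### The one-dimensional Laguerre kernel -/

/-- The entire function `w ↦ ∑ w ^ m / (m! Γ(m + α + 1))`, which is `I_α(2 √w) / √w ^ α`. -/
noncomputable def besselSeries (α w : ℝ) : ℝ :=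
  ∑' m : ℕ, w ^ m / ((m ! : ℝ) * Real.Gamma ((m : ℝ) + α + 1))

lemma Gamma_nat_add_pos {α : ℝ} (hα : -1 < α) (m : ℕ) : 0 < Real.Gamma ((m : ℝ) + α + 1) := by
  have hm : (0 : ℝ) ≤ m := m.cast_nonneg
  exact Real.Gamma_pos_of_pos (by linarith)

lemma Gamma_nat_succ_add {α : ℝ} (hα : -1 < α) (m : ℕ) :
    Real.Gamma (((m + 1 : ℕ) : ℝ) + α + 1) = ((m : ℝ) + α + 1) * Real.Gamma ((m : ℝ) + α + 1) := by
  have hm : (0 : ℝ) ≤ m := m.cast_nonneg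
  rw [← Real.Gamma_add_one (by linarith)]
  congr 1
  push_cast
  ring

lemma min_mul_Gamma_le {α : ℝ} (hα : -1 < α) (m : ℕ) :
    min 1 (α + 1) * Real.Gamma (α + 1) ≤ Real.Gamma ((m : ℝ) + α + 1) := by
  have hG : 0 < Real.Gamma (α + 1) := Real.Gamma_pos_of_pos (by linarith)
  induction m with
  | zero =>
    simp only [Nat.cast_zero, zero_add]
    exact mul_le_of_le_one_left hG.le (min_le_left _ _)
  | succ m ih =>
    rw [Gamma_nat_succ_add hα]
    rcases m.eq_zero_or_pos with rfl | hm
    · simp only [Nat.cast_zero, zero_add]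
      exact mul_le_mul_of_nonneg_right (min_le_right _ _) hG.le
    · have hm' : (1 : ℝ) ≤ m := by exact_mod_cast hm
      refine ih.trans (le_mul_of_one_le_left (Gamma_nat_add_pos hα m).le (by linarith))

lemma summable_besselSeries {α : ℝ} (hα : -1 < α) (w : ℝ) :
    Summable fun m : ℕ => w ^ m / ((m ! : ℝ) * Real.Gamma ((m : ℝ) + α + 1)) := by
  have hG : 0 < Real.Gamma (α + 1) := Real.Gamma_pos_of_pos (by linarith)
  have hc : 0 < min 1 (α + 1) * Real.Gamma (α + 1) :=
    mul_pos (lt_min one_pos (by linarith)) hG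
  refine Summable.of_norm_bounded
    ((Real.summable_pow_div_factorial |w|).div_const (min 1 (α + 1) * Real.Gamma (α + 1)))
    fun m => ?_
  rw [norm_div, norm_mul, norm_pow, Real.norm_eq_abs,
    Real.norm_of_nonneg (Gamma_nat_add_pos hα m).le,
    Real.norm_of_nonneg (by positivity), ← div_div]
  exact div_le_div_of_nonneg_left (by positivity) hc (min_mul_Gamma_le hα m)

lemma measurable_besselSeries {α : ℝ} (hα : -1 < α) : Measurable (besselSeries α) := by
  refine measurable_of_tendsto_metrizable (f := fun n w => ∑ m ∈ Finset.range n,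
    w ^ m / ((m ! : ℝ) * Real.Gamma ((m : ℝ) + α + 1))) (fun n => by fun_prop) ?_
  rw [tendsto_pi_nhds]
  exact fun w => (summable_besselSeries hα w).hasSum.tendsto_sum_nat

lemma besselModI_eq {α z : ℝ} (hz : 0 < z) :
    besselModI α z = (z / 2) ^ α * besselSeries α ((z / 2) ^ 2) := by
  unfold besselModI besselSeries
  rw [← tsum_mul_left]
  refine tsum_congr fun m => ?_
  rw [add_comm (2 * (m : ℝ)) α, Real.rpow_add (by positivity), ← pow_mul,
    show (2 * (m : ℝ)) = ((2 * m : ℕ) : ℝ) by push_cast; ring, Real.rpow_natCast]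
  ring

/-- The one-dimensional Laguerre heat kernel in the variable `r = e ^ (-t)`. The Bessel function is
replaced by the entire function `besselSeries`, so that no singular powers of `x` and `y` occur. -/
noncomputable def laguerreKernel (α r x y : ℝ) : ℝ :=
  Real.Gamma (α + 1) * ((1 - r) ^ (α + 1))⁻¹ * Real.exp (-(r / (1 - r)) * (x + y))
    * besselSeries α (r * x * y / (1 - r) ^ 2)

lemma laguerreKernel_comm (α r x y : ℝ) : laguerreKernel α r x y = laguerreKernel α r y x := by
  unfold laguerreKernel
  rw [add_comm x y, mul_right_comm r x y]

lemma laguerreKernel_nonneg {α r x y : ℝ} (hα : -1 < α) (hr : 0 < r) (hr1 : r < 1) (hx : 0 < x)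
    (hy : 0 < y) : 0 ≤ laguerreKernel α r x y := by
  have h1 : 0 < 1 - r := by linarith
  have hG : 0 < Real.Gamma (α + 1) := Real.Gamma_pos_of_pos (by linarith)
  have hB : 0 ≤ besselSeries α (r * x * y / (1 - r) ^ 2) :=
    tsum_nonneg fun m => by have := Gamma_nat_add_pos hα m; positivity
  unfold laguerreKernel
  positivity

lemma laguerreHeatKernel_factor {α r x y : ℝ} (hr : 0 < r) (hr1 : r < 1) (hx : 0 < x)
    (hy : 0 < y) :
    Real.Gamma (α + 1) / (1 - r) * Real.exp (-(r / (1 - r)) * (x + y)) * √(r * x * y) ^ (-α)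
      * besselModI α (2 * √(r * x * y) / (1 - r)) = laguerreKernel α r x y := by
  have h1 : 0 < 1 - r := by linarith
  have hq : 0 < √(r * x * y) := by positivity
  rw [besselModI_eq (by positivity)]
  have e1 : 2 * √(r * x * y) / (1 - r) / 2 = √(r * x * y) / (1 - r) := by ring
  have e2 : (√(r * x * y) / (1 - r)) ^ 2 = r * x * y / (1 - r) ^ 2 := by
    rw [div_pow, Real.sq_sqrt (by positivity)]
  have hα' := (Real.rpow_pos_of_pos hq α).ne'
  have hβ' := (Real.rpow_pos_of_pos h1 α).ne'
  rw [e1, e2, Real.div_rpow hq.le h1.le, Real.rpow_neg hq.le, laguerreKernel, Real.rpow_add h1,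
    Real.rpow_one]
  field_simp

/-! ### The action of the one-dimensional kernel on Laguerre polynomials -/

/-- A form of the Chu–Vandermonde identity. -/
lemma sum_choose_mul_descFactorial_div_Gamma (j : ℕ) :
    ∀ {α : ℝ}, -1 < α → ∀ m : ℕ,
    ∑ i ∈ Finset.range (j + 1),
        (j.choose i : ℝ) * (m.descFactorial i / Real.Gamma ((i : ℝ) + α + 1))
      = Real.Gamma (((m + j : ℕ) : ℝ) + α + 1)
        / (Real.Gamma ((m : ℝ) + α + 1) * Real.Gamma ((j : ℝ) + α + 1)) := by
  induction j with
  | zero =>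
    intro α hα m
    have h1 := Gamma_nat_add_pos hα m
    have h2 := Gamma_nat_add_pos hα 0
    simp only [Nat.cast_zero] at h2
    simp
    field_simp
  | succ j ih =>
    intro α hα m
    rw [Finset.sum_choose_succ_mul
      (fun i _ => (m.descFactorial i : ℝ) / Real.Gamma ((i : ℝ) + α + 1)) j,
      ih hα m]
    have hm := Gamma_nat_add_pos hα m
    have hj := Gamma_nat_add_pos hα j
    have hmj := Gamma_nat_add_pos hα (m + j)
    have hj0 : (0 : ℝ) ≤ j := j.cast_nonneg
    have hjp : 0 < (j : ℝ) + α + 1 := by linarith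
    have e1 : m + (j + 1) = m + j + 1 := by ring
    rw [e1, Gamma_nat_succ_add hα (m + j), Gamma_nat_succ_add hα j]
    cases m with
    | zero =>
      simp only [Nat.zero_descFactorial_succ, Nat.cast_zero, zero_div, mul_zero,
        Finset.sum_const_zero, zero_add, add_zero] at hm ⊢
      field_simp
    | succ m =>
      have ih' := ih (α := α + 1) (by linarith) m
      have e2 : ∀ i : ℕ, Real.Gamma (((i + 1 : ℕ) : ℝ) + α + 1)
          = Real.Gamma ((i : ℝ) + (α + 1) + 1) := fun i => by
        congr 1; push_cast; ring
      have e3 : ((m + j : ℕ) : ℝ) + (α + 1) + 1 = ((m + 1 + j : ℕ) : ℝ) + α + 1 := by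
        push_cast; ring
      have e4 : (m : ℝ) + (α + 1) + 1 = ((m + 1 : ℕ) : ℝ) + α + 1 := by push_cast; ring
      have e5 : Real.Gamma ((j : ℝ) + (α + 1) + 1)
          = ((j : ℝ) + α + 1) * Real.Gamma ((j : ℝ) + α + 1) := by
        rw [← e2, Gamma_nat_succ_add hα]
      have e6 : ∑ i ∈ Finset.range (j + 1), (j.choose i : ℝ) *
          (((m + 1).descFactorial (i + 1) : ℝ) / Real.Gamma (((i + 1 : ℕ) : ℝ) + α + 1))
          = ((m + 1 : ℕ) : ℝ) * ∑ i ∈ Finset.range (j + 1), (j.choose i : ℝ) *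
            ((m.descFactorial i : ℝ) / Real.Gamma ((i : ℝ) + (α + 1) + 1)) := by
        rw [Finset.mul_sum]
        refine Finset.sum_congr rfl fun i _ => ?_
        rw [Nat.succ_descFactorial_succ, e2]
        push_cast
        ring
      rw [e6, ih', e3, e4, e5]
      field_simp
      push_cast
      ring

/-- The factorial moments of the Poisson distribution. -/
lemma hasSum_descFactorial_mul_pow_div_factorial (i : ℕ) (c : ℝ) :
    HasSum (fun m : ℕ => (m.descFactorial i : ℝ) * (c ^ m / m !)) (c ^ i * Real.exp c) := by
  have h := (NormedSpace.expSeries_div_hasSum_exp c).mul_left (c ^ i)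
  rw [← Real.exp_eq_exp_ℝ] at h
  have h0 : ∑ m ∈ Finset.range i, (m.descFactorial i : ℝ) * (c ^ m / m !) = 0 :=
    Finset.sum_eq_zero fun m hm => by
      rw [Nat.descFactorial_of_lt (Finset.mem_range.1 hm)]; simp
  rw [← add_zero (c ^ i * Real.exp c), ← h0, ← hasSum_nat_add_iff i]
  convert! h using 2 with m
  have := Nat.factorial_mul_descFactorial (n := m + i) (k := i) (by omega)
  rw [Nat.add_sub_cancel] at this
  rw [← this]
  have h1 : ((m + i).descFactorial i : ℝ) ≠ 0 := by
    exact_mod_cast (Nat.descFactorial_pos.2 (by omega)).ne'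
  have h2 : (m ! : ℝ) ≠ 0 := by positivity
  push_cast
  field_simp
  ring

/-- On the monomials normalized by `Γ(j + α + 1)` the Laguerre kernel acts by binomial thinning.
The kernel is the mixture, over a Poisson variable `m`, of Gamma distributions with parameter
`m + α + 1`, and the moments of the latter are summed by the Chu–Vandermonde identity. -/
lemma integral_laguerreKernel_mul_pow {α r x : ℝ} (hα : -1 < α) (hr : 0 < r) (hr1 : r < 1)
    (hx : 0 < x) (j : ℕ) :
    ∫ y, laguerreKernel α r x y * y ^ j ∂(laguerreMeasureOne α)
      = Real.Gamma ((j : ℝ) + α + 1) * ∑ i ∈ Finset.range (j + 1),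
        (j.choose i : ℝ) * (r ^ i * (1 - r) ^ (j - i) * (x ^ i / Real.Gamma ((i : ℝ) + α + 1))) := by
  have h1 : 0 < 1 - r := by linarith
  have hG : 0 < Real.Gamma (α + 1) := Real.Gamma_pos_of_pos (by linarith)
  set q : ℝ := r / (1 - r) with hq
  have hq0 : 0 < q := by positivity
  have hq1 : 1 / (1 + q) = 1 - r := by rw [hq]; field_simp; ring
  set c : ℝ := q * x with hc
  set A : ℝ := Real.Gamma (α + 1) * ((1 - r) ^ (α + 1))⁻¹ * Real.exp (-c) with hA
  set B : ℕ → ℝ := fun m =>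
    A * ((c / (1 - r)) ^ m / ((m ! : ℝ) * Real.Gamma ((m : ℝ) + α + 1))) with hB
  set F : ℕ → ℝ → ℝ := fun m y => B m * (y ^ (m + j) * Real.exp (-(q * y))) with hF
  have hFint : ∀ m, Integrable (F m) (laguerreMeasureOne α) := fun m =>
    (integrable_pow_mul_exp_laguerreMeasureOne hα (m + j) (by linarith)).const_mul _
  have hFval : ∀ m, ∫ y, F m y ∂(laguerreMeasureOne α) = Real.exp (-c) * (1 - r) ^ j *
      Real.Gamma ((j : ℝ) + α + 1) * ∑ i ∈ Finset.range (j + 1), (j.choose i : ℝ) *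
        (((m.descFactorial i : ℝ) * (c ^ m / m !)) / Real.Gamma ((i : ℝ) + α + 1)) := by
    intro m
    have hm := Gamma_nat_add_pos hα m
    have hj := Gamma_nat_add_pos hα j
    have hp : (1 - r) ^ (((m + j : ℕ) : ℝ) + α + 1)
        = (1 - r) ^ m * (1 - r) ^ j * (1 - r) ^ (α + 1) := by
      rw [add_assoc, Real.rpow_add h1, Real.rpow_natCast, pow_add]
    have hsum : ∑ i ∈ Finset.range (j + 1), (j.choose i : ℝ) *
        (((m.descFactorial i : ℝ) * (c ^ m / m !)) / Real.Gamma ((i : ℝ) + α + 1))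
        = c ^ m / m ! * (Real.Gamma (((m + j : ℕ) : ℝ) + α + 1)
        / (Real.Gamma ((m : ℝ) + α + 1) * Real.Gamma ((j : ℝ) + α + 1))) := by
      rw [← sum_choose_mul_descFactorial_div_Gamma j hα m, Finset.mul_sum]
      exact Finset.sum_congr rfl fun i _ => by ring
    have hpp : 0 < (1 - r) ^ (α + 1) := by positivity
    rw [hsum, hF]
    simp only
    rw [integral_const_mul, integral_pow_mul_exp_laguerreMeasureOne hα _ (by linarith), hq1, hp, hB,
      hA]
    simp only [div_pow]
    field_simp
  have hFsum : HasSum (fun m => ∫ y, F m y ∂(laguerreMeasureOne α))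
      (Real.exp (-c) * (1 - r) ^ j * Real.Gamma ((j : ℝ) + α + 1) *
        ∑ i ∈ Finset.range (j + 1), (j.choose i : ℝ) *
        ((c ^ i * Real.exp c) / Real.Gamma ((i : ℝ) + α + 1))) := by
    simp_rw [hFval]
    exact (hasSum_sum fun i _ =>
      ((hasSum_descFactorial_mul_pow_div_factorial i c).div_const _).mul_left _).mul_left _
  have hFnorm : ∀ m, ∫ y, ‖F m y‖ ∂(laguerreMeasureOne α) = ∫ y, F m y ∂(laguerreMeasureOne α) := by
    intro m
    refine integral_congr_ae ?_
    filter_upwards [ae_pos_laguerreMeasureOne α] with y hy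
    have hm := Gamma_nat_add_pos hα m
    refine Real.norm_of_nonneg ?_
    simp only [hF, hB, hA]
    positivity
  have key := (hasSum_integral_of_summable_integral_norm hFint
    (by simp_rw [hFnorm]; exact hFsum.summable)).unique hFsum
  have hker : ∀ y, ∑' m, F m y = laguerreKernel α r x y * y ^ j := by
    intro y
    simp only [hF, hB, laguerreKernel, besselSeries]
    rw [← tsum_mul_left, ← tsum_mul_right]
    refine tsum_congr fun m => ?_
    have e1 : Real.exp (-(r / (1 - r)) * (x + y)) = Real.exp (-c) * Real.exp (-(q * y)) := by
      rw [← Real.exp_add, hc, hq]; ring_nf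
    have e2 : (r * x * y / (1 - r) ^ 2) ^ m = (c / (1 - r)) ^ m * y ^ m := by
      rw [← mul_pow, hc, hq]; congr 1; field_simp
    rw [e1, e2, hA, pow_add]
    ring
  simp_rw [hker] at key
  rw [key, Finset.mul_sum, Finset.mul_sum]
  refine Finset.sum_congr rfl fun i hi => ?_
  have hij : i ≤ j := Nat.lt_succ_iff.1 (Finset.mem_range.1 hi)
  have e1 : (1 - r) ^ j * c ^ i = r ^ i * (1 - r) ^ (j - i) * x ^ i := by
    rw [← Nat.sub_add_cancel hij, pow_add, Nat.sub_add_cancel hij, hc, hq, mul_pow, div_pow]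
    field_simp
  have e2 : Real.exp (-c) * Real.exp c = 1 := by rw [← Real.exp_add]; simp
  have hi' := Gamma_nat_add_pos hα i
  calc _ = Real.Gamma ((j : ℝ) + α + 1) * ((j.choose i : ℝ) * (((1 - r) ^ j * c ^ i)
        / Real.Gamma ((i : ℝ) + α + 1))) * (Real.exp (-c) * Real.exp c) := by ring
    _ = _ := by rw [e1, e2]; ring

lemma integrable_laguerreKernel_mul_pow {α r x : ℝ} (hα : -1 < α) (hr : 0 < r) (hr1 : r < 1)
    (hx : 0 < x) (j : ℕ) :
    Integrable (fun y => laguerreKernel α r x y * y ^ j) (laguerreMeasureOne α) := by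
  refine Integrable.of_integral_ne_zero ?_
  rw [integral_laguerreKernel_mul_pow hα hr hr1 hx]
  have h1 : 0 < 1 - r := by linarith
  refine (mul_pos (Gamma_nat_add_pos hα j) (Finset.sum_pos (fun i hi => ?_) (by simp))).ne'
  have hi' := Gamma_nat_add_pos hα i
  have := Nat.choose_pos (Nat.lt_succ_iff.1 (Finset.mem_range.1 hi))
  positivity

/-- The umbral functional `X ^ i ↦ e i` on polynomials. -/
noncomputable def umbral (e : ℕ → ℝ) : Polynomial ℝ →ₗ[ℝ] ℝ :=
  Polynomial.lsum fun i => (LinearMap.id : ℝ →ₗ[ℝ] ℝ).smulRight (e i)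

lemma umbral_pow (e : ℕ → ℝ) (u v : ℝ) (j : ℕ) :
    umbral e ((Polynomial.C u * Polynomial.X + Polynomial.C v) ^ j)
      = ∑ i ∈ Finset.range (j + 1), (j.choose i : ℝ) * (u ^ i * v ^ (j - i) * e i) := by
  rw [add_pow, map_sum]
  refine Finset.sum_congr rfl fun i _ => ?_
  have : (Polynomial.C u * Polynomial.X) ^ i * Polynomial.C v ^ (j - i)
      * (j.choose i : Polynomial ℝ)
      = Polynomial.monomial i (u ^ i * v ^ (j - i) * j.choose i) := by
    rw [← Polynomial.C_mul_X_pow_eq_monomial, mul_pow]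
    simp only [map_mul, map_pow, map_natCast]
    ring
  rw [this, umbral, Polynomial.lsum_apply, Polynomial.sum_monomial_index _ _ (by simp)]
  simp
  ring

lemma laguerrePoly_eq_sum_choose {α : ℝ} (k : ℕ) (x : ℝ) :
    laguerrePoly α k x = Real.Gamma ((k : ℝ) + α + 1) / k ! * ∑ j ∈ Finset.range (k + 1),
      (k.choose j : ℝ) * ((-1) ^ j * (x ^ j / Real.Gamma ((j : ℝ) + α + 1))) := by
  unfold laguerrePoly
  rw [Finset.mul_sum]
  refine Finset.sum_congr rfl fun j hj => ?_
  rw [Nat.cast_choose ℝ (Nat.lt_succ_iff.1 (Finset.mem_range.1 hj))]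
  have h2 : (k ! : ℝ) ≠ 0 := by positivity
  field_simp

/-- The Laguerre polynomials are eigenfunctions of the Laguerre kernel. Under the umbral
correspondence `X ^ i ↔ x ^ i / Γ(i + α + 1)` the kernel is the substitution `X ↦ r X + (1 - r)`
and `L_k` is a multiple of `(1 - X) ^ k`, which this substitution multiplies by `r ^ k`. -/
lemma integral_laguerreKernel_mul_laguerrePoly {α r x : ℝ} (hα : -1 < α) (hr : 0 < r) (hr1 : r < 1)
    (hx : 0 < x) (k : ℕ) :
    ∫ y, laguerreKernel α r x y * laguerrePoly α k y ∂(laguerreMeasureOne α)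
      = r ^ k * laguerrePoly α k x := by
  set e : ℕ → ℝ := fun i => x ^ i / Real.Gamma ((i : ℝ) + α + 1) with he
  have hL : laguerrePoly α k x = Real.Gamma ((k : ℝ) + α + 1) / k ! *
      umbral e ((Polynomial.C (-1) * Polynomial.X + Polynomial.C 1) ^ k) := by
    rw [laguerrePoly_eq_sum_choose, umbral_pow]
    simp [he]
  have hT : ∀ j : ℕ, ∫ y, laguerreKernel α r x y * y ^ j ∂(laguerreMeasureOne α)
      = Real.Gamma ((j : ℝ) + α + 1) *
        umbral e ((Polynomial.C r * Polynomial.X + Polynomial.C (1 - r)) ^ j) := by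
    intro j
    rw [integral_laguerreKernel_mul_pow hα hr hr1 hx, umbral_pow]
  have hLy : ∀ y, laguerreKernel α r x y * laguerrePoly α k y
      = ∑ j ∈ Finset.range (k + 1), (Real.Gamma ((k : ℝ) + α + 1) / k ! * (k.choose j *
        ((-1) ^ j / Real.Gamma ((j : ℝ) + α + 1)))) * (laguerreKernel α r x y * y ^ j) := by
    intro y
    rw [laguerrePoly_eq_sum_choose, Finset.mul_sum, Finset.mul_sum]
    exact Finset.sum_congr rfl fun j _ => by ring
  simp_rw [hLy]
  rw [integral_finsetSum _ fun j _ =>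
    (integrable_laguerreKernel_mul_pow hα hr hr1 hx j).const_mul _]
  simp_rw [integral_const_mul, hT]
  have hpoly : ∑ j ∈ Finset.range (k + 1), ((k.choose j : ℝ) * (-1) ^ j) •
      (Polynomial.C r * Polynomial.X + Polynomial.C (1 - r)) ^ j
      = r ^ k • (Polynomial.C (-1) * Polynomial.X + Polynomial.C (1 : ℝ)) ^ k := by
    have h1 : r ^ k • (Polynomial.C (-1) * Polynomial.X + Polynomial.C (1 : ℝ)) ^ k
        = (-(Polynomial.C r * Polynomial.X + Polynomial.C (1 - r)) + 1) ^ k := by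
      rw [Polynomial.smul_eq_C_mul, Polynomial.C_pow, ← mul_pow]
      congr 1
      simp only [map_sub, map_neg, map_one]
      ring
    rw [h1, add_pow]
    refine Finset.sum_congr rfl fun j _ => ?_
    rw [Polynomial.smul_eq_C_mul]
    simp only [map_mul, map_pow, map_natCast, map_neg, map_one, one_pow, mul_one]
    rw [neg_pow (Polynomial.C r * Polynomial.X + Polynomial.C (1 - r))]
    ring
  have h2 := congrArg (umbral e) hpoly
  rw [map_sum, map_smul, smul_eq_mul] at h2
  simp only [map_smul, smul_eq_mul] at h2
  rw [hL, mul_left_comm, ← h2, Finset.mul_sum]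
  refine Finset.sum_congr rfl fun j _ => ?_
  have hj := Gamma_nat_add_pos hα j
  field_simp

lemma integrable_laguerreKernel_mul_laguerrePoly {α r x : ℝ} (hα : -1 < α) (hr : 0 < r)
    (hr1 : r < 1) (hx : 0 < x) (k : ℕ) :
    Integrable (fun y => laguerreKernel α r x y * laguerrePoly α k y) (laguerreMeasureOne α) := by
  have hLy : ∀ y, laguerreKernel α r x y * laguerrePoly α k y
      = ∑ j ∈ Finset.range (k + 1), (Real.Gamma ((k : ℝ) + α + 1) / k ! * (k.choose j *
        ((-1) ^ j / Real.Gamma ((j : ℝ) + α + 1)))) * (laguerreKernel α r x y * y ^ j) := by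
    intro y
    rw [laguerrePoly_eq_sum_choose, Finset.mul_sum, Finset.mul_sum]
    exact Finset.sum_congr rfl fun j _ => by ring
  simp_rw [hLy]
  exact integrable_finsetSum _ fun j _ =>
    (integrable_laguerreKernel_mul_pow hα hr hr1 hx j).const_mul _

/-! ### The Laguerre kernel in several variables -/

section Kernel

variable {d : ℕ} {α : Fin d → ℝ}

/-- The Laguerre heat kernel as a product of the one-dimensional kernels `laguerreKernel`. It
agrees with `laguerreHeatKernel` on the open orthant. -/
noncomputable def laguerreKernelPi (α : Fin d → ℝ) (t : ℝ) (x y : Fin d → ℝ) : ℝ :=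
  ∏ j, laguerreKernel (α j) (Real.exp (-t)) (x j) (y j)

lemma isProbabilityMeasure_laguerreMeasure (hα : ∀ i, -1 < α i) :
    IsProbabilityMeasure (laguerreMeasure α) := by
  have : ∀ i, IsProbabilityMeasure (laguerreMeasureOne (α i)) := fun i =>
    isProbabilityMeasure_laguerreMeasureOne (hα i)
  rw [laguerreMeasure_eq_pi]
  infer_instance

instance sigmaFinite_laguerreMeasure (α : Fin d → ℝ) : SigmaFinite (laguerreMeasure α) := by
  rw [laguerreMeasure_eq_pi]
  infer_instance

lemma ae_pos_laguerreMeasure (α : Fin d → ℝ) : ∀ᵐ x ∂(laguerreMeasure α), ∀ i, 0 < x i := by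
  rw [laguerreMeasure_eq_pi, ae_all_iff]
  intro i
  exact (Measure.quasiMeasurePreserving_eval (μ := fun i => laguerreMeasureOne (α i)) i).ae
    (ae_pos_laguerreMeasureOne (α i))

lemma measurable_laguerreKernelPi (hα : ∀ i, -1 < α i) :
    Measurable fun p : (ℝ × (Fin d → ℝ)) × (Fin d → ℝ) => laguerreKernelPi α p.1.1 p.1.2 p.2 := by
  unfold laguerreKernelPi laguerreKernel
  refine Finset.measurable_fun_prod _ fun j _ => ?_
  have := measurable_besselSeries (hα j)
  have h1 : Measurable fun p : (ℝ × (Fin d → ℝ)) × (Fin d → ℝ) =>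
      Real.exp (-p.1.1) * p.1.2 j * p.2 j / (1 - Real.exp (-p.1.1)) ^ 2 := by fun_prop
  have h2 := this.comp h1
  simp only [Function.comp_def] at h2
  refine Measurable.mul ?_ h2
  fun_prop

lemma laguerreKernelPi_comm (t : ℝ) (x y : Fin d → ℝ) :
    laguerreKernelPi α t x y = laguerreKernelPi α t y x :=
  Finset.prod_congr rfl fun _ _ => laguerreKernel_comm _ _ _ _

lemma exp_neg_lt_one_of_pos {t : ℝ} (ht : 0 < t) : Real.exp (-t) < 1 :=
  Real.exp_lt_one_iff.mpr (by linarith)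

lemma laguerreKernelPi_nonneg (hα : ∀ i, -1 < α i) {t : ℝ} (ht : 0 < t) {x y : Fin d → ℝ}
    (hx : ∀ i, 0 < x i) (hy : ∀ i, 0 < y i) : 0 ≤ laguerreKernelPi α t x y :=
  Finset.prod_nonneg fun j _ => laguerreKernel_nonneg (hα j) (Real.exp_pos _)
    (exp_neg_lt_one_of_pos ht) (hx j) (hy j)

lemma laguerreHeatKernel_eq {t : ℝ} (ht : 0 < t) {x y : Fin d → ℝ}
    (hx : ∀ i, 0 < x i) (hy : ∀ i, 0 < y i) :
    laguerreHeatKernel α t x y = laguerreKernelPi α t x y :=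
  Finset.prod_congr rfl fun j _ => laguerreHeatKernel_factor (Real.exp_pos _)
    (exp_neg_lt_one_of_pos ht) (hx j) (hy j)

lemma measurable_laguerrePolyPi (k : Fin d → ℕ) : Measurable (laguerrePolyPi α k) := by
  unfold laguerrePolyPi laguerrePoly
  fun_prop

lemma integrable_laguerrePolyPi (hα : ∀ i, -1 < α i) (k : Fin d → ℕ) :
    Integrable (laguerrePolyPi α k) (laguerreMeasure α) := by
  rw [laguerreMeasure_eq_pi]
  exact Integrable.fintype_prod fun i => integrable_laguerrePoly (hα i) (k i)

lemma laguerrePolyPi_zero (hα : ∀ i, -1 < α i) (x : Fin d → ℝ) :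
    laguerrePolyPi α (fun _ => 0) x = 1 := by
  unfold laguerrePolyPi laguerrePoly
  refine Finset.prod_eq_one fun i _ => ?_
  have h1 : 0 < Real.Gamma (α i + 1) := Real.Gamma_pos_of_pos (by linarith [hα i])
  simp [h1.ne']

lemma integrable_laguerreKernelPi_mul (hα : ∀ i, -1 < α i) {t : ℝ} (ht : 0 < t) {x : Fin d → ℝ}
    (hx : ∀ i, 0 < x i) (k : Fin d → ℕ) :
    Integrable (fun y => laguerreKernelPi α t x y * laguerrePolyPi α k y) (laguerreMeasure α) := by
  simp only [laguerreKernelPi, laguerrePolyPi, ← Finset.prod_mul_distrib]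
  rw [laguerreMeasure_eq_pi]
  exact Integrable.fintype_prod (f := fun i y => laguerreKernel (α i) (Real.exp (-t)) (x i) y *
    laguerrePoly (α i) (k i) y) fun i => integrable_laguerreKernel_mul_laguerrePoly (hα i)
      (Real.exp_pos _) (exp_neg_lt_one_of_pos ht) (hx i) (k i)

lemma integral_laguerreKernelPi_mul (hα : ∀ i, -1 < α i) {t : ℝ} (ht : 0 < t) {x : Fin d → ℝ}
    (hx : ∀ i, 0 < x i) (k : Fin d → ℕ) :
    ∫ y, laguerreKernelPi α t x y * laguerrePolyPi α k y ∂(laguerreMeasure α)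
      = Real.exp (-(((∑ i, k i : ℕ) : ℝ) * t)) * laguerrePolyPi α k x := by
  simp only [laguerreKernelPi, laguerrePolyPi, ← Finset.prod_mul_distrib]
  rw [laguerreMeasure_eq_pi, integral_fintype_prod_eq_prod (fun i y =>
    laguerreKernel (α i) (Real.exp (-t)) (x i) y * laguerrePoly (α i) (k i) y)]
  simp_rw [fun i => integral_laguerreKernel_mul_laguerrePoly (hα i) (Real.exp_pos _)
    (exp_neg_lt_one_of_pos ht) (hx i) (k i)]
  rw [Finset.prod_mul_distrib, Finset.prod_pow_eq_pow_sum, ← Real.exp_nat_mul]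
  congr 2
  ring

lemma integrable_laguerreKernelPi (hα : ∀ i, -1 < α i) {t : ℝ} (ht : 0 < t) {x : Fin d → ℝ}
    (hx : ∀ i, 0 < x i) : Integrable (laguerreKernelPi α t x) (laguerreMeasure α) := by
  simpa [laguerrePolyPi_zero hα] using integrable_laguerreKernelPi_mul hα ht hx fun _ => 0

lemma integral_laguerreKernelPi (hα : ∀ i, -1 < α i) {t : ℝ} (ht : 0 < t) {x : Fin d → ℝ}
    (hx : ∀ i, 0 < x i) : ∫ y, laguerreKernelPi α t x y ∂(laguerreMeasure α) = 1 := by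
  simpa [laguerrePolyPi_zero hα] using integral_laguerreKernelPi_mul hα ht hx fun _ => 0

end Kernel

/-! ### The heat semigroup on bounded functions -/

section Heat

variable {𝕜 : Type*} [RCLike 𝕜] {d : ℕ} {α : Fin d → ℝ}

/-- The integral operator with kernel `laguerreKernelPi`; for `t > 0` it is the Laguerre
semigroup. -/
noncomputable def kernelHeat (α : Fin d → ℝ) (f : (Fin d → ℝ) → 𝕜) (t : ℝ) (x : Fin d → ℝ) : 𝕜 :=
  ∫ y, laguerreKernelPi α t x y • f y ∂(laguerreMeasure α)

/-- The pairing of `f` with the Laguerre polynomial `L_k`, an unnormalized Laguerre coefficient. -/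
noncomputable def laguerreCoeff (α : Fin d → ℝ) (f : (Fin d → ℝ) → 𝕜) (k : Fin d → ℕ) : 𝕜 :=
  ∫ x, laguerrePolyPi α k x • f x ∂(laguerreMeasure α)

lemma laguerreCoeff_congr_ae {f g : (Fin d → ℝ) → 𝕜} (h : f =ᵐ[laguerreMeasure α] g)
    (k : Fin d → ℕ) : laguerreCoeff α f k = laguerreCoeff α g k := by
  refine integral_congr_ae ?_
  filter_upwards [h] with x hx
  rw [hx]

lemma laguerreHeat_eq_kernelHeat {t : ℝ} (ht : 0 < t) (f : (Fin d → ℝ) → 𝕜) {x : Fin d → ℝ}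
    (hx : ∀ i, 0 < x i) : laguerreHeat α t f x = kernelHeat α f t x := by
  rw [laguerreHeat, if_neg ht.ne', kernelHeat]
  refine integral_congr_ae ?_
  filter_upwards [ae_pos_laguerreMeasure α] with y hy
  rw [laguerreHeatKernel_eq ht hx hy]

variable {f : (Fin d → ℝ) → 𝕜} {M : ℝ}

lemma stronglyMeasurable_kernelHeat (hα : ∀ i, -1 < α i)
    (hf : AEStronglyMeasurable f (laguerreMeasure α)) :
    StronglyMeasurable fun p : ℝ × (Fin d → ℝ) => kernelHeat α f p.1 p.2 := by
  have : (fun p : ℝ × (Fin d → ℝ) => kernelHeat α f p.1 p.2)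
      = fun p => ∫ y, laguerreKernelPi α p.1 p.2 y • hf.mk f y ∂(laguerreMeasure α) := by
    ext p
    refine integral_congr_ae ?_
    filter_upwards [hf.ae_eq_mk] with y hy
    rw [hy]
  rw [this]
  refine StronglyMeasurable.integral_prod_right' (f := fun q : (ℝ × (Fin d → ℝ)) × (Fin d → ℝ) =>
    laguerreKernelPi α q.1.1 q.1.2 q.2 • hf.mk f q.2) ?_
  exact (measurable_laguerreKernelPi hα).stronglyMeasurable.smul
    (hf.stronglyMeasurable_mk.comp_measurable measurable_snd)

lemma norm_kernelHeat_le (hα : ∀ i, -1 < α i) (hM : ∀ᵐ x ∂(laguerreMeasure α), ‖f x‖ ≤ M)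
    {t : ℝ} (ht : 0 < t) {x : Fin d → ℝ} (hx : ∀ i, 0 < x i) : ‖kernelHeat α f t x‖ ≤ M := by
  refine (norm_integral_le_of_norm_le ((integrable_laguerreKernelPi hα ht hx).mul_const M)
    ?_).trans_eq ?_
  · filter_upwards [hM, ae_pos_laguerreMeasure α] with y hy hy'
    have := laguerreKernelPi_nonneg hα ht hx hy'
    rw [norm_smul, Real.norm_of_nonneg this]
    exact mul_le_mul_of_nonneg_left hy this
  · rw [integral_mul_const, integral_laguerreKernelPi hα ht hx, one_mul]

lemma integrable_smul_of_bounded {X : Type*} [MeasurableSpace X] {μ : Measure X} {g : X → ℝ}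
    {f : X → 𝕜} (hg : Integrable g μ) (hf : AEStronglyMeasurable f μ)
    (hM : ∀ᵐ x ∂μ, ‖f x‖ ≤ M) : Integrable (fun x => g x • f x) μ := by
  refine (hg.norm.mul_const M).mono' (hg.1.smul hf) ?_
  filter_upwards [hM] with x hx
  rw [norm_smul]
  exact mul_le_mul_of_nonneg_left hx (norm_nonneg _)

/-- By the symmetry of the kernel, the heat semigroup multiplies the `k`-th Laguerre coefficient by
`e^{-|k| t}`. -/
lemma laguerreCoeff_kernelHeat (hα : ∀ i, -1 < α i)
    (hf : AEStronglyMeasurable f (laguerreMeasure α)) (hM : ∀ᵐ x ∂(laguerreMeasure α), ‖f x‖ ≤ M)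
    {t : ℝ} (ht : 0 < t) (k : Fin d → ℕ) :
    laguerreCoeff α (kernelHeat α f t) k
      = Real.exp (-(((∑ i, k i : ℕ) : ℝ) * t)) • laguerreCoeff α f k := by
  set μ := laguerreMeasure α with hμ
  have hKm : Measurable fun p : (Fin d → ℝ) × (Fin d → ℝ) => laguerreKernelPi α t p.1 p.2 := by
    have h : Measurable fun p : (Fin d → ℝ) × (Fin d → ℝ) => ((t, p.1), p.2) := by fun_prop
    have h2 := (measurable_laguerreKernelPi hα).comp h
    exact h2
  have hmeas : AEStronglyMeasurable (fun p : (Fin d → ℝ) × (Fin d → ℝ) =>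
      laguerrePolyPi α k p.1 • (laguerreKernelPi α t p.1 p.2 • f p.2)) (μ.prod μ) :=
    ((measurable_laguerrePolyPi k).comp measurable_fst).aestronglyMeasurable.smul
      (hKm.aestronglyMeasurable.smul hf.comp_snd)
  have hint : Integrable (fun p : (Fin d → ℝ) × (Fin d → ℝ) =>
      laguerrePolyPi α k p.1 • (laguerreKernelPi α t p.1 p.2 • f p.2)) (μ.prod μ) := by
    refine (integrable_prod_iff hmeas).2 ⟨?_, ?_⟩
    · filter_upwards [ae_pos_laguerreMeasure α] with x hx
      exact (integrable_smul_of_bounded (integrable_laguerreKernelPi hα ht hx) hf hM).smul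
        (laguerrePolyPi α k x)
    · refine ((integrable_laguerrePolyPi hα k).norm.mul_const M).mono'
        hmeas.norm.integral_prod_right' ?_
      filter_upwards [ae_pos_laguerreMeasure α] with x hx
      rw [Real.norm_of_nonneg (integral_nonneg fun _ => norm_nonneg _)]
      simp_rw [norm_smul]
      rw [integral_const_mul]
      refine mul_le_mul_of_nonneg_left ?_ (norm_nonneg _)
      rw [← one_mul M, ← integral_laguerreKernelPi hα ht hx, ← integral_mul_const]
      refine integral_mono_of_nonneg (Filter.Eventually.of_forall fun _ => by positivity)
        ((integrable_laguerreKernelPi hα ht hx).mul_const M) ?_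
      filter_upwards [hM, ae_pos_laguerreMeasure α] with y hy hy'
      have := laguerreKernelPi_nonneg hα ht hx hy'
      rw [Real.norm_of_nonneg this]
      exact mul_le_mul_of_nonneg_left hy this
  calc laguerreCoeff α (kernelHeat α f t) k
      = ∫ x, ∫ y, laguerrePolyPi α k x • (laguerreKernelPi α t x y • f y) ∂μ ∂μ := by
        simp only [laguerreCoeff, kernelHeat, integral_smul, hμ]
    _ = ∫ y, ∫ x, laguerrePolyPi α k x • (laguerreKernelPi α t x y • f y) ∂μ ∂μ :=
        integral_integral_swap hint
    _ = ∫ y, Real.exp (-(((∑ i, k i : ℕ) : ℝ) * t)) • (laguerrePolyPi α k y • f y) ∂μ := by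
        refine integral_congr_ae ?_
        filter_upwards [ae_pos_laguerreMeasure α] with y hy
        have h := integral_laguerreKernelPi_mul hα ht hy k
        rw [smul_smul, ← h, ← integral_smul_const]
        refine integral_congr_ae (Filter.Eventually.of_forall fun x => ?_)
        simp only
        rw [smul_smul, laguerreKernelPi_comm, mul_comm]
    _ = _ := by rw [integral_smul]; rfl

/-! ### The Poisson semigroup on bounded functions -/

/-- The Poisson–Laguerre semigroup, written with `poissonDensity`. -/
noncomputable def poisson (α : Fin d → ℝ) (f : (Fin d → ℝ) → 𝕜) (s : ℝ) (x : Fin d → ℝ) : 𝕜 :=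
  subordinate (fun v => kernelHeat α f (1 / (4 * v)) x) s

/-- The derivative of the Poisson–Laguerre semigroup with respect to time. -/
noncomputable def poissonDeriv (α : Fin d → ℝ) (f : (Fin d → ℝ) → 𝕜) (s : ℝ) (x : Fin d → ℝ) : 𝕜 :=
  subordinateDeriv (fun v => kernelHeat α f (1 / (4 * v)) x) s

lemma laguerrePoisson_eq_poisson {s : ℝ} (hs : 0 < s) (f : (Fin d → ℝ) → 𝕜) {x : Fin d → ℝ}
    (hx : ∀ i, 0 < x i) : laguerrePoisson α s f x = poisson α f s x := by
  have h := integral_comp_mul_left_Ioi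
    (fun u : ℝ => (Real.exp (-u) / √u) • laguerreHeat α (s ^ 2 / (4 * u)) f x) 0
    (b := s ^ 2) (by positivity)
  rw [mul_zero, eq_inv_smul_iff₀ (by positivity)] at h
  rw [laguerrePoisson, ← h, poisson, subordinate, ← integral_smul, ← integral_smul]
  refine setIntegral_congr_fun measurableSet_Ioi fun v hv => ?_
  have hv : 0 < v := hv
  have e1 : s ^ 2 / (4 * (s ^ 2 * v)) = 1 / (4 * v) := by field_simp
  rw [e1, laguerreHeat_eq_kernelHeat (by positivity) f hx, smul_smul, smul_smul, poissonDensity,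
    Real.sqrt_mul (by positivity), Real.sqrt_sq hs.le]
  congr 1
  field_simp

lemma stronglyMeasurable_kernelHeat_section (hα : ∀ i, -1 < α i)
    (hf : AEStronglyMeasurable f (laguerreMeasure α)) :
    StronglyMeasurable fun p : (Fin d → ℝ) × ℝ => kernelHeat α f (1 / (4 * p.2)) p.1 := by
  have h : Measurable fun p : (Fin d → ℝ) × ℝ => (1 / (4 * p.2), p.1) := by fun_prop
  have h2 := (stronglyMeasurable_kernelHeat hα hf).comp_measurable h
  exact h2

lemma aestronglyMeasurable_kernelHeat_section (hα : ∀ i, -1 < α i)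
    (hf : AEStronglyMeasurable f (laguerreMeasure α)) (x : Fin d → ℝ) :
    AEStronglyMeasurable (fun v : ℝ => kernelHeat α f (1 / (4 * v)) x)
      (volume.restrict (Ioi 0)) := by
  have h2 := (stronglyMeasurable_kernelHeat_section hα hf).comp_measurable
    (measurable_prodMk_left (x := x))
  exact h2.aestronglyMeasurable

lemma norm_kernelHeat_section_le (hα : ∀ i, -1 < α i)
    (hM : ∀ᵐ x ∂(laguerreMeasure α), ‖f x‖ ≤ M) {x : Fin d → ℝ} (hx : ∀ i, 0 < x i) (v : ℝ)
    (hv : 0 < v) : ‖kernelHeat α f (1 / (4 * v)) x‖ ≤ M :=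
  norm_kernelHeat_le hα hM (by positivity) hx

lemma stronglyMeasurable_poisson (hα : ∀ i, -1 < α i)
    (hf : AEStronglyMeasurable f (laguerreMeasure α)) :
    StronglyMeasurable fun p : ℝ × (Fin d → ℝ) => poisson α f p.1 p.2 := by
  refine StronglyMeasurable.integral_prod_right' (ν := volume.restrict (Ioi (0 : ℝ)))
    (f := fun q : (ℝ × (Fin d → ℝ)) × ℝ =>
      poissonDensity q.1.1 q.2 • kernelHeat α f (1 / (4 * q.2)) q.1.2) ?_
  have h1 : Measurable fun q : (ℝ × (Fin d → ℝ)) × ℝ => (q.1.1, q.2) := by fun_prop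
  have h2 : Measurable fun q : (ℝ × (Fin d → ℝ)) × ℝ => (q.1.2, q.2) := by fun_prop
  have h3 := (measurable_poissonDensity.comp h1).stronglyMeasurable
  have h4 := (stronglyMeasurable_kernelHeat_section hα hf).comp_measurable h2
  exact h3.smul h4

lemma stronglyMeasurable_poissonDeriv (hα : ∀ i, -1 < α i)
    (hf : AEStronglyMeasurable f (laguerreMeasure α)) :
    StronglyMeasurable fun p : ℝ × (Fin d → ℝ) => poissonDeriv α f p.1 p.2 := by
  refine StronglyMeasurable.integral_prod_right' (ν := volume.restrict (Ioi (0 : ℝ)))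
    (f := fun q : (ℝ × (Fin d → ℝ)) × ℝ =>
      poissonDensityDeriv q.1.1 q.2 • kernelHeat α f (1 / (4 * q.2)) q.1.2) ?_
  have h1 : Measurable fun q : (ℝ × (Fin d → ℝ)) × ℝ => (q.1.1, q.2) := by fun_prop
  have h2 : Measurable fun q : (ℝ × (Fin d → ℝ)) × ℝ => (q.1.2, q.2) := by fun_prop
  have h3 := (measurable_poissonDensityDeriv.comp h1).stronglyMeasurable
  have h4 := (stronglyMeasurable_kernelHeat_section hα hf).comp_measurable h2
  exact h3.smul h4

lemma stronglyMeasurable_poisson_right (hα : ∀ i, -1 < α i)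
    (hf : AEStronglyMeasurable f (laguerreMeasure α)) (s : ℝ) :
    StronglyMeasurable (poisson α f s) := by
  have h := (stronglyMeasurable_poisson hα hf).comp_measurable (measurable_prodMk_left (x := s))
  exact h

lemma stronglyMeasurable_poissonDeriv_right (hα : ∀ i, -1 < α i)
    (hf : AEStronglyMeasurable f (laguerreMeasure α)) (s : ℝ) :
    StronglyMeasurable (poissonDeriv α f s) := by
  have h := (stronglyMeasurable_poissonDeriv hα hf).comp_measurable
    (measurable_prodMk_left (x := s))
  exact h

lemma norm_poisson_le (hα : ∀ i, -1 < α i) (hM : ∀ᵐ x ∂(laguerreMeasure α), ‖f x‖ ≤ M)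
    {s : ℝ} (hs : 0 < s) {x : Fin d → ℝ} (hx : ∀ i, 0 < x i) : ‖poisson α f s x‖ ≤ M :=
  norm_subordinate_le (norm_kernelHeat_section_le hα hM hx) hs

lemma norm_poissonDeriv_le (hα : ∀ i, -1 < α i) (hM : ∀ᵐ x ∂(laguerreMeasure α), ‖f x‖ ≤ M)
    {s : ℝ} (hs : 0 < s) {x : Fin d → ℝ} (hx : ∀ i, 0 < x i) :
    ‖poissonDeriv α f s x‖ ≤ 2 * M / s :=
  norm_subordinateDeriv_le (norm_kernelHeat_section_le hα hM hx) hs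

lemma hasDerivAt_laguerrePoisson (hα : ∀ i, -1 < α i)
    (hf : AEStronglyMeasurable f (laguerreMeasure α)) (hM : ∀ᵐ x ∂(laguerreMeasure α), ‖f x‖ ≤ M)
    {s : ℝ} (hs : 0 < s) {x : Fin d → ℝ} (hx : ∀ i, 0 < x i) :
    HasDerivAt (fun s => laguerrePoisson α s f x) (poissonDeriv α f s x) s := by
  have h : HasDerivAt (fun s => poisson α f s x) (poissonDeriv α f s x) s :=
    hasDerivAt_subordinate (aestronglyMeasurable_kernelHeat_section hα hf x)
      (norm_kernelHeat_section_le hα hM hx) hs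
  refine h.congr_of_eventuallyEq ?_
  filter_upwards [Ioi_mem_nhds hs] with r hr
  exact laguerrePoisson_eq_poisson hr f hx

/-- Laguerre coefficients of an integral of the heat semigroup over time. -/
lemma laguerreCoeff_integral_kernelHeat (hα : ∀ i, -1 < α i)
    (hf : AEStronglyMeasurable f (laguerreMeasure α)) (hM : ∀ᵐ x ∂(laguerreMeasure α), ‖f x‖ ≤ M)
    {w : ℝ → ℝ} (hw : IntegrableOn w (Ioi 0)) (k : Fin d → ℕ) :
    laguerreCoeff α (fun x => ∫ v in Ioi (0 : ℝ), w v • kernelHeat α f (1 / (4 * v)) x) k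
      = (∫ v in Ioi (0 : ℝ), w v * Real.exp (-(((∑ i, k i : ℕ) : ℝ) / (4 * v))))
        • laguerreCoeff α f k := by
  set μ := laguerreMeasure α with hμ
  set ν : Measure ℝ := volume.restrict (Ioi (0 : ℝ)) with hν
  have hint : Integrable (fun p : (Fin d → ℝ) × ℝ =>
      laguerrePolyPi α k p.1 • (w p.2 • kernelHeat α f (1 / (4 * p.2)) p.1)) (μ.prod ν) := by
    have h1 : Integrable (fun p : (Fin d → ℝ) × ℝ => laguerrePolyPi α k p.1 * w p.2) (μ.prod ν) :=
      (integrable_laguerrePolyPi hα k).mul_prod hw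
    simp only [smul_smul]
    refine integrable_smul_of_bounded (M := M) h1
      (stronglyMeasurable_kernelHeat_section hα hf).aestronglyMeasurable ?_
    have hpx : ∀ᵐ p ∂(μ.prod ν), ∀ i, 0 < p.1 i :=
      Measure.quasiMeasurePreserving_fst.ae (ae_pos_laguerreMeasure α)
    have hpv : ∀ᵐ p ∂(μ.prod ν), 0 < p.2 :=
      Measure.quasiMeasurePreserving_snd.ae (p := fun v : ℝ => 0 < v)
        (ae_restrict_mem measurableSet_Ioi)
    filter_upwards [hpx, hpv] with p hp1 hp2
    exact norm_kernelHeat_section_le hα hM hp1 _ hp2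
  calc laguerreCoeff α (fun x => ∫ v in Ioi (0 : ℝ), w v • kernelHeat α f (1 / (4 * v)) x) k
      = ∫ x, ∫ v, laguerrePolyPi α k x • (w v • kernelHeat α f (1 / (4 * v)) x) ∂ν ∂μ := by
        simp only [laguerreCoeff, integral_smul, hμ, hν]
    _ = ∫ v, ∫ x, laguerrePolyPi α k x • (w v • kernelHeat α f (1 / (4 * v)) x) ∂μ ∂ν :=
        integral_integral_swap hint
    _ = ∫ v, (w v * Real.exp (-(((∑ i, k i : ℕ) : ℝ) / (4 * v)))) • laguerreCoeff α f k ∂ν := by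
        refine setIntegral_congr_fun measurableSet_Ioi fun v hv => ?_
        have hv : 0 < v := hv
        have h := laguerreCoeff_kernelHeat hα hf hM (t := 1 / (4 * v)) (by positivity) k
        rw [mul_one_div] at h
        rw [← smul_smul, ← h, laguerreCoeff, ← integral_smul]
        exact integral_congr_ae (Filter.Eventually.of_forall fun x => smul_comm _ _ _)
    _ = _ := integral_smul_const _ _

lemma laguerreCoeff_poisson (hα : ∀ i, -1 < α i)
    (hf : AEStronglyMeasurable f (laguerreMeasure α)) (hM : ∀ᵐ x ∂(laguerreMeasure α), ‖f x‖ ≤ M)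
    {s : ℝ} (hs : 0 < s) (k : Fin d → ℕ) :
    laguerreCoeff α (poisson α f s) k
      = Real.exp (-(s * √((∑ i, k i : ℕ) : ℝ))) • laguerreCoeff α f k := by
  rw [← subordinate_exp (Nat.cast_nonneg _) hs]
  exact laguerreCoeff_integral_kernelHeat hα hf hM (integrableOn_poissonDensity hs) k

lemma laguerreCoeff_poissonDeriv (hα : ∀ i, -1 < α i)
    (hf : AEStronglyMeasurable f (laguerreMeasure α)) (hM : ∀ᵐ x ∂(laguerreMeasure α), ‖f x‖ ≤ M)
    {s : ℝ} (hs : 0 < s) (k : Fin d → ℕ) :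
    laguerreCoeff α (poissonDeriv α f s) k
      = (-√((∑ i, k i : ℕ) : ℝ) * Real.exp (-(s * √((∑ i, k i : ℕ) : ℝ)))) •
        laguerreCoeff α f k := by
  rw [← subordinateDeriv_exp (Nat.cast_nonneg _) hs]
  exact laguerreCoeff_integral_kernelHeat hα hf hM (integrableOn_poissonDensityDeriv hs) k

end Heat

/-! ### Completeness of the Laguerre polynomials -/

section Completeness

/-- Random variables with exponential moments and with the same moments have the same
characteristic function: their complex moment generating functions are analytic on a vertical strip
and have the same Taylor series at `0`. -/
lemma complexMGF_mul_I_eq_of_moments {Ω : Type*} [MeasurableSpace Ω] {ν₁ ν₂ : Measure Ω}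
    {X : Ω → ℝ} (h₁ : 0 ∈ interior (ProbabilityTheory.integrableExpSet X ν₁))
    (h₂ : 0 ∈ interior (ProbabilityTheory.integrableExpSet X ν₂))
    (h : ∀ n : ℕ, ∫ ω, X ω ^ n ∂ν₁ = ∫ ω, X ω ^ n ∂ν₂) (t : ℝ) :
    ProbabilityTheory.complexMGF X ν₁ (t * Complex.I)
      = ProbabilityTheory.complexMGF X ν₂ (t * Complex.I) := by
  set U : Set ℂ := {z | z.re ∈ interior (ProbabilityTheory.integrableExpSet X ν₁) ∩
    interior (ProbabilityTheory.integrableExpSet X ν₂)} with hU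
  have hconv : Convex ℝ U :=
    (ProbabilityTheory.convex_integrableExpSet.interior.inter
      ProbabilityTheory.convex_integrableExpSet.interior).linear_preimage Complex.reLm
  have hA₁ : AnalyticOnNhd ℂ (ProbabilityTheory.complexMGF X ν₁) U := fun z hz =>
    ProbabilityTheory.analyticAt_complexMGF hz.1
  have hA₂ : AnalyticOnNhd ℂ (ProbabilityTheory.complexMGF X ν₂) U := fun z hz =>
    ProbabilityTheory.analyticAt_complexMGF hz.2
  have h0 : (0 : ℂ) ∈ U := ⟨by simpa using h₁, by simpa using h₂⟩
  have hev : ProbabilityTheory.complexMGF X ν₁ =ᶠ[nhds 0] ProbabilityTheory.complexMGF X ν₂ := by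
    have hs₁ := (hA₁ 0 h0).hasFPowerSeriesAt
    have hs₂ := (hA₂ 0 h0).hasFPowerSeriesAt
    have hd : ∀ n : ℕ, iteratedDeriv n (ProbabilityTheory.complexMGF X ν₁) 0
        = iteratedDeriv n (ProbabilityTheory.complexMGF X ν₂) 0 := by
      intro n
      rw [ProbabilityTheory.iteratedDeriv_complexMGF h0.1,
        ProbabilityTheory.iteratedDeriv_complexMGF h0.2]
      simp only [zero_mul, Complex.exp_zero, mul_one, ← Complex.ofReal_pow]
      rw [integral_complex_ofReal, integral_complex_ofReal, h n]
    simp_rw [hd] at hs₁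
    have := (hs₁.sub hs₂)
    rw [sub_self] at this
    filter_upwards [this.eventually_eq_zero] with z hz
    exact sub_eq_zero.1 hz
  refine hA₁.eqOn_of_preconnected_of_eventuallyEq hA₂ hconv.isPreconnected h0 hev ?_
  simpa [hU] using ⟨h₁, h₂⟩

lemma pow_mem_span_laguerrePoly {α : ℝ} (hα : -1 < α) (j : ℕ) :
    (fun x : ℝ => x ^ j) ∈ Submodule.span ℝ (range (laguerrePoly α)) := by
  induction j using Nat.strong_induction_on with
  | _ j ih =>
    set c : ℕ → ℝ := fun i => (-1) ^ i * Real.Gamma ((j : ℝ) + α + 1)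
      / (Real.Gamma ((i : ℝ) + α + 1) * ((j - i)! : ℝ) * (i ! : ℝ)) with hc
    have hcj : c j ≠ 0 := by
      have := Gamma_nat_add_pos hα j
      simp only [hc, Nat.sub_self, Nat.factorial_zero]
      positivity
    have h : (fun x : ℝ => x ^ j)
        = (c j)⁻¹ • (laguerrePoly α j - ∑ i ∈ Finset.range j, c i • fun x : ℝ => x ^ i) := by
      ext x
      have : laguerrePoly α j x = ∑ i ∈ Finset.range (j + 1), c i * x ^ i := rfl
      rw [Finset.sum_range_succ] at this
      simp [this, hcj]
    rw [h]
    refine Submodule.smul_mem _ _ (Submodule.sub_mem _ (Submodule.subset_span ⟨j, rfl⟩)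
      (Submodule.sum_mem _ fun i hi => Submodule.smul_mem _ _ (ih i (Finset.mem_range.1 hi))))

variable {𝕜 : Type*} [RCLike 𝕜] {d : ℕ} {α : Fin d → ℝ}

lemma integrable_eval_mvPolynomial (hα : ∀ i, -1 < α i) (p : MvPolynomial (Fin d) ℝ) :
    Integrable (fun y => MvPolynomial.eval y p) (laguerreMeasure α) := by
  induction p using MvPolynomial.induction_on' with
  | monomial u a =>
    simp only [MvPolynomial.eval_monomial, Finsupp.prod_pow]
    refine Integrable.const_mul ?_ _
    rw [laguerreMeasure_eq_pi]
    refine Integrable.fintype_prod (f := fun i (y : ℝ) => y ^ u i) fun i => ?_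
    simpa using integrable_pow_mul_exp_laguerreMeasureOne (hα i) (u i) (c := 0) (by norm_num)
  | add p q hp hq =>
    simp only [map_add]
    exact hp.add hq

lemma integral_eval_mvPolynomial_smul_eq_zero (hα : ∀ i, -1 < α i) {g : (Fin d → ℝ) → 𝕜} {M : ℝ}
    (hg : AEStronglyMeasurable g (laguerreMeasure α)) (hM : ∀ᵐ x ∂(laguerreMeasure α), ‖g x‖ ≤ M)
    (h : ∀ k, laguerreCoeff α g k = 0) (p : MvPolynomial (Fin d) ℝ) :
    ∫ y, MvPolynomial.eval y p • g y ∂(laguerreMeasure α) = 0 := by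
  induction p using MvPolynomial.induction_on' with
  | monomial u a =>
    have hspan : ∀ i, ∃ c : ℕ →₀ ℝ, ∀ x : ℝ,
        x ^ u i = ∑ k ∈ c.support, c k * laguerrePoly (α i) k x := by
      intro i
      obtain ⟨c, hc⟩ := Finsupp.mem_span_range_iff_exists_finsupp.1
        (pow_mem_span_laguerrePoly (hα i) (u i))
      refine ⟨c, fun x => ?_⟩
      have := congrFun hc x
      simpa [Finsupp.sum] using this.symm
    choose c hc using hspan
    have hprod : ∀ y : Fin d → ℝ, ∏ i, y i ^ u i
        = ∑ k ∈ Fintype.piFinset fun i => (c i).support,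
          (∏ i, c i (k i)) * laguerrePolyPi α k y := by
      intro y
      simp_rw [hc, Finset.prod_univ_sum, laguerrePolyPi, Finset.prod_mul_distrib]
    simp only [MvPolynomial.eval_monomial, Finsupp.prod_pow, hprod]
    simp_rw [Finset.mul_sum, Finset.sum_smul]
    rw [integral_finsetSum]
    · refine Finset.sum_eq_zero fun k _ => ?_
      simp_rw [← mul_assoc, mul_smul _ (laguerrePolyPi α k _), integral_smul]
      rw [show ∫ x, laguerrePolyPi α k x • g x ∂(laguerreMeasure α) = 0 from h k, smul_zero]
    · intro k _
      exact integrable_smul_of_bounded (((integrable_laguerrePolyPi hα k).const_mul _).const_mul _)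
        hg hM
  | add p q hp hq =>
    simp only [map_add, add_smul]
    rw [integral_add, hp, hq, add_zero]
    · exact integrable_smul_of_bounded (integrable_eval_mvPolynomial hα p) hg hM
    · exact integrable_smul_of_bounded (integrable_eval_mvPolynomial hα q) hg hM

/-- Linear functionals have exponential moments with respect to the Laguerre measure. -/
lemma zero_mem_interior_integrableExpSet (hα : ∀ i, -1 < α i) (L : StrongDual ℝ (Fin d → ℝ)) :
    0 ∈ interior (ProbabilityTheory.integrableExpSet L (laguerreMeasure α)) := by
  classical
  set b : Fin d → ℝ := fun i => L (Pi.single i 1) with hb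
  have hL : ∀ y, L y = ∑ i, y i * b i := fun y => by
    have := LinearMap.pi_apply_eq_sum_univ (L : (Fin d → ℝ) →ₗ[ℝ] ℝ) y
    simp only [ContinuousLinearMap.coe_coe, smul_eq_mul] at this
    rw [this]
    refine Finset.sum_congr rfl fun i _ => ?_
    congr 2
    ext j
    simp [Pi.single_apply, eq_comm]
  set S : ℝ := 1 + ∑ i, |b i| with hS
  have hS0 : 0 < S := by
    have : 0 ≤ ∑ i, |b i| := Finset.sum_nonneg fun _ _ => abs_nonneg _
    linarith
  rw [mem_interior_iff_mem_nhds]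
  filter_upwards [Ioo_mem_nhds (neg_lt_zero.2 (inv_pos.2 hS0)) (inv_pos.2 hS0)] with t ht
  have hti : ∀ i, -1 < -(t * b i) := by
    intro i
    have h1 : |t| < S⁻¹ := abs_lt.2 ht
    have h2 : |b i| ≤ S := by
      have := Finset.single_le_sum (f := fun i => |b i|) (fun _ _ => abs_nonneg _)
        (Finset.mem_univ i)
      linarith
    have h3 : |t * b i| < 1 := by
      rw [abs_mul]
      calc |t| * |b i| ≤ |t| * S := by gcongr
        _ < S⁻¹ * S := by gcongr
        _ = 1 := inv_mul_cancel₀ hS0.ne'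
    linarith [(abs_lt.1 h3).2]
  show Integrable _ _
  have he : ∀ y : Fin d → ℝ, Real.exp (t * L y)
      = ∏ i, (y i ^ 0 * Real.exp (-(-(t * b i) * y i))) := by
    intro y
    simp only [pow_zero, one_mul]
    rw [hL, ← Real.exp_sum, Finset.mul_sum]
    congr 1
    exact Finset.sum_congr rfl fun i _ => by ring
  simp_rw [he]
  rw [laguerreMeasure_eq_pi]
  exact Integrable.fintype_prod (f := fun i (y : ℝ) => y ^ 0 * Real.exp (-(-(t * b i) * y)))
    fun i => integrable_pow_mul_exp_laguerreMeasureOne (hα i) 0 (hti i)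

lemma exists_mvPolynomial_eval_eq (L : StrongDual ℝ (Fin d → ℝ)) :
    ∃ p : MvPolynomial (Fin d) ℝ, ∀ y, MvPolynomial.eval y p = L y := by
  classical
  refine ⟨∑ i, MvPolynomial.X i * MvPolynomial.C (L (Pi.single i 1)), fun y => ?_⟩
  have := LinearMap.pi_apply_eq_sum_univ (L : (Fin d → ℝ) →ₗ[ℝ] ℝ) y
  simp only [ContinuousLinearMap.coe_coe, smul_eq_mul] at this
  rw [this]
  simp only [map_sum, map_mul, MvPolynomial.eval_X, MvPolynomial.eval_C]
  refine Finset.sum_congr rfl fun i _ => ?_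
  congr 2
  ext j
  simp [Pi.single_apply, eq_comm]

/-- A bounded real function that is orthogonal to all polynomials vanishes: the finite measures
`(M + g) μ` and `M μ` have the same moments, hence the same characteristic function. -/
lemma ae_eq_zero_of_integral_mvPolynomial (hα : ∀ i, -1 < α i) {g : (Fin d → ℝ) → ℝ} {M : ℝ}
    (hg : AEStronglyMeasurable g (laguerreMeasure α)) (hM : ∀ᵐ x ∂(laguerreMeasure α), ‖g x‖ ≤ M)
    (h : ∀ p : MvPolynomial (Fin d) ℝ, ∫ y, MvPolynomial.eval y p • g y ∂(laguerreMeasure α) = 0) :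
    g =ᵐ[laguerreMeasure α] 0 := by
  have := isProbabilityMeasure_laguerreMeasure hα
  set μ := laguerreMeasure α with hμ
  have hM0 : 0 ≤ M := by
    obtain ⟨x, hx⟩ := hM.exists
    exact (norm_nonneg _).trans hx
  have key : ∀ u : (Fin d → ℝ) → ℝ, AEMeasurable u μ → (∀ᵐ x ∂μ, 0 ≤ u x ∧ u x ≤ 2 * M) →
      IsFiniteMeasure (μ.withDensity fun x => ENNReal.ofReal (u x)) ∧
      (∀ L : StrongDual ℝ (Fin d → ℝ), 0 ∈ interior (ProbabilityTheory.integrableExpSet L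
        (μ.withDensity fun x => ENNReal.ofReal (u x)))) ∧
      ∀ w : (Fin d → ℝ) → ℝ, ∫ x, w x ∂(μ.withDensity fun x => ENNReal.ofReal (u x))
        = ∫ x, u x * w x ∂μ := by
    intro u hu hub
    have hle : (μ.withDensity fun x => ENNReal.ofReal (u x)) ≤ ENNReal.ofReal (2 * M) • μ := by
      rw [← withDensity_const]
      refine withDensity_mono ?_
      filter_upwards [hub] with x hx
      exact ENNReal.ofReal_le_ofReal hx.2
    refine ⟨⟨(hle univ).trans_lt ?_⟩, fun L => ?_, fun w => ?_⟩
    · rw [Measure.smul_apply, measure_univ, smul_eq_mul, mul_one]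
      exact ENNReal.ofReal_lt_top
    · refine interior_mono ?_ (zero_mem_interior_integrableExpSet hα L)
      intro t ht
      exact (Integrable.smul_measure ht ENNReal.ofReal_ne_top).mono_measure hle
    · rw [integral_withDensity_eq_integral_toReal_smul₀ hu.ennreal_ofReal (by simp)]
      refine integral_congr_ae ?_
      filter_upwards [hub] with x hx
      rw [ENNReal.toReal_ofReal hx.1, smul_eq_mul]
  have hgm : AEMeasurable g μ := hg.aemeasurable
  obtain ⟨hf₁, hE₁, hI₁⟩ := key (fun x => M + g x) (hgm.const_add M) (by
    filter_upwards [hM] with x hx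
    have := abs_le.1 (Real.norm_eq_abs (g x) ▸ hx)
    constructor <;> linarith [this.1, this.2])
  obtain ⟨hf₂, hE₂, hI₂⟩ := key (fun _ => M) aemeasurable_const
    (Filter.Eventually.of_forall fun _ => ⟨hM0, by linarith⟩)
  have heq : (μ.withDensity fun x => ENNReal.ofReal (M + g x))
      = μ.withDensity fun _ => ENNReal.ofReal M := by
    refine Measure.ext_of_charFunDual ?_
    ext L
    rw [charFunDual_eq_charFun_map_one, charFunDual_eq_charFun_map_one,
      ← ProbabilityTheory.complexMGF_mul_I (by fun_prop),
      ← ProbabilityTheory.complexMGF_mul_I (by fun_prop)]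
    refine complexMGF_mul_I_eq_of_moments (hE₁ L) (hE₂ L) (fun n => ?_) 1
    obtain ⟨p, hp⟩ := exists_mvPolynomial_eval_eq L
    rw [hI₁, hI₂]
    have hLp : ∀ y, L y ^ n = MvPolynomial.eval y (p ^ n) := fun y => by rw [map_pow, hp]
    simp_rw [hLp, add_mul]
    rw [integral_add ((integrable_eval_mvPolynomial hα _).const_mul _)]
    · simp_rw [mul_comm (g _)]
      have := h (p ^ n)
      simp only [smul_eq_mul] at this
      rw [this, add_zero]
    · simp_rw [mul_comm (g _)]
      exact integrable_smul_of_bounded (𝕜 := ℝ) (integrable_eval_mvPolynomial hα _) hg hM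
  have hfin : ∫⁻ x, ENNReal.ofReal (M + g x) ∂μ ≠ ∞ := by
    have := hf₁.measure_univ_lt_top
    rw [withDensity_apply _ MeasurableSet.univ, Measure.restrict_univ] at this
    exact this.ne
  have hae := (withDensity_eq_iff (hgm.const_add M).ennreal_ofReal aemeasurable_const hfin).1 heq
  filter_upwards [hae, hM] with x hx hxM
  have h1 := abs_le.1 (Real.norm_eq_abs (g x) ▸ hxM)
  have h2 : M + g x = M := by
    rwa [ENNReal.ofReal_eq_ofReal_iff (by linarith [h1.1]) hM0] at hx
  simpa using h2

/-- A bounded function is determined by its Laguerre coefficients. -/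
lemma ae_eq_of_laguerreCoeff_eq (hα : ∀ i, -1 < α i) {f g : (Fin d → ℝ) → 𝕜} {M N : ℝ}
    (hf : AEStronglyMeasurable f (laguerreMeasure α)) (hM : ∀ᵐ x ∂(laguerreMeasure α), ‖f x‖ ≤ M)
    (hg : AEStronglyMeasurable g (laguerreMeasure α)) (hN : ∀ᵐ x ∂(laguerreMeasure α), ‖g x‖ ≤ N)
    (h : ∀ k, laguerreCoeff α f k = laguerreCoeff α g k) : f =ᵐ[laguerreMeasure α] g := by
  have hd : AEStronglyMeasurable (fun x => f x - g x) (laguerreMeasure α) := hf.sub hg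
  have hdM : ∀ᵐ x ∂(laguerreMeasure α), ‖f x - g x‖ ≤ M + N := by
    filter_upwards [hM, hN] with x h1 h2
    exact (norm_sub_le _ _).trans (add_le_add h1 h2)
  have hd0 : ∀ k, laguerreCoeff α (fun x => f x - g x) k = 0 := by
    intro k
    have h1 := integrable_smul_of_bounded (integrable_laguerrePolyPi hα k) hf hM
    have h2 := integrable_smul_of_bounded (integrable_laguerrePolyPi hα k) hg hN
    simp only [laguerreCoeff, smul_sub]
    rw [integral_sub h1 h2]
    exact sub_eq_zero.2 (h k)
  have hp := integral_eval_mvPolynomial_smul_eq_zero hα hd hdM hd0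
  have hlin : ∀ (T : 𝕜 →L[ℝ] ℝ), (∀ z, ‖T z‖ ≤ ‖z‖) →
      (fun x => T (f x - g x)) =ᵐ[laguerreMeasure α] 0 := by
    intro T hT
    refine ae_eq_zero_of_integral_mvPolynomial hα (M := M + N)
      (T.continuous.comp_aestronglyMeasurable hd) ?_ fun p => ?_
    · filter_upwards [hdM] with x hx
      exact (hT _).trans hx
    · have h1 := T.integral_comp_comm
        (integrable_smul_of_bounded (integrable_eval_mvPolynomial hα p) hd hdM)
      rw [hp p, map_zero] at h1
      simpa using h1
  filter_upwards [hlin RCLike.reCLM fun z => RCLike.norm_re_le_norm z,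
    hlin RCLike.imCLM fun z => RCLike.norm_im_le_norm z] with x h1 h2
  refine sub_eq_zero.1 (RCLike.ext ?_ ?_)
  · simpa using h1
  · simpa using h2

end Completeness

/-! ### The weight `s ^ (-λ - 1)` and the constant `c_λ` -/

section Weight

/-- The majorants `s ^ (-λ - 1) min(a s ^ γ, c)` of the integrands of fractional derivatives. The
two regimes are separated at a prescribed point `t`. -/
noncomputable def fracMajorant (lam γ a c t s : ℝ) : ℝ :=
  s ^ (-lam - 1) * if s ≤ t then a * s ^ γ else c

variable {lam γ a c t : ℝ}

lemma measurable_fracMajorant : Measurable (fracMajorant lam γ a c t) := by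
  unfold fracMajorant
  refine Measurable.mul (by fun_prop) (Measurable.ite measurableSet_Iic (by fun_prop) (by fun_prop))

lemma fracMajorant_integrableOn_and_integral (hlam : 0 < lam) (hγ : lam < γ) (ht : 0 < t) :
    IntegrableOn (fracMajorant lam γ a c t) (Ioi 0) ∧
    ∫ s in Ioi (0 : ℝ), fracMajorant lam γ a c t s
      = a * t ^ (γ - lam) / (γ - lam) + c * t ^ (-lam) / lam := by
  have h1 : EqOn (fun s : ℝ => a * s ^ (γ - lam - 1)) (fracMajorant lam γ a c t) (Ioc 0 t) := by
    intro s hs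
    simp only [fracMajorant, if_pos hs.2]
    rw [mul_left_comm, ← Real.rpow_add hs.1]
    ring_nf
  have h2 : EqOn (fun s : ℝ => c * s ^ (-lam - 1)) (fracMajorant lam γ a c t) (Ioi t) := by
    intro s hs
    have hs : t < s := hs
    simp only [fracMajorant, if_neg (not_le.2 hs)]
    ring
  have i1 : IntegrableOn (fun s : ℝ => a * s ^ (γ - lam - 1)) (Ioc 0 t) := by
    have : IntervalIntegrable (fun s : ℝ => s ^ (γ - lam - 1)) volume 0 t :=
      intervalIntegral.intervalIntegrable_rpow' (by linarith)
    rw [intervalIntegrable_iff_integrableOn_Ioc_of_le ht.le] at this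
    exact this.const_mul a
  have i2 : IntegrableOn (fun s : ℝ => c * s ^ (-lam - 1)) (Ioi t) :=
    (integrableOn_Ioi_rpow_of_lt (by linarith) ht).const_mul c
  have j1 := i1.congr_fun h1 measurableSet_Ioc
  have j2 := i2.congr_fun h2 measurableSet_Ioi
  rw [← Ioc_union_Ioi_eq_Ioi ht.le]
  refine ⟨j1.union j2, ?_⟩
  rw [setIntegral_union Ioc_disjoint_Ioi_same measurableSet_Ioi j1 j2,
    ← setIntegral_congr_fun measurableSet_Ioc h1, ← setIntegral_congr_fun measurableSet_Ioi h2,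
    ← intervalIntegral.integral_of_le ht.le, intervalIntegral.integral_const_mul,
    integral_const_mul, integral_rpow (Or.inl (by linarith)),
    integral_Ioi_rpow_of_lt (by linarith) ht]
  have e1 : γ - lam - 1 + 1 = γ - lam := by ring
  have e2 : -lam - 1 + 1 = -lam := by ring
  rw [e1, e2, Real.zero_rpow (by linarith)]
  have := hlam.ne'
  have : γ - lam ≠ 0 := by linarith
  field_simp
  ring

lemma integrableOn_fracConst (hlam : 0 < lam) (hlam1 : lam < 1) :
    IntegrableOn (fun u : ℝ => u ^ (-lam - 1) * (Real.exp (-u) - 1)) (Ioi 0) := by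
  refine (fracMajorant_integrableOn_and_integral (a := 1) (c := 1) hlam hlam1 one_pos).1.mono'
    (by fun_prop : Measurable _).aestronglyMeasurable ?_
  filter_upwards [ae_restrict_mem measurableSet_Ioi] with u hu
  have hu : 0 < u := hu
  have h1 : Real.exp (-u) ≤ 1 := Real.exp_le_one_iff.2 (by linarith)
  have h2 := Real.add_one_le_exp (-u)
  have h3 := Real.exp_pos (-u)
  rw [norm_mul, Real.norm_of_nonneg (by positivity), Real.norm_of_nonpos (by linarith),
    fracMajorant]
  refine mul_le_mul_of_nonneg_left ?_ (by positivity)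
  split_ifs
  · rw [Real.rpow_one]; linarith
  · linarith

lemma laguerreFracConst_neg (hlam : 0 < lam) (hlam1 : lam < 1) : laguerreFracConst lam < 0 := by
  have h : IntegrableOn (fun u : ℝ => -(u ^ (-lam - 1) * (Real.exp (-u) - 1))) (Ioi 0) :=
    (integrableOn_fracConst hlam hlam1).neg
  have hpos : ∀ u : ℝ, 0 < u → 0 < -(u ^ (-lam - 1) * (Real.exp (-u) - 1)) := by
    intro u hu
    have h1 : Real.exp (-u) < 1 := exp_neg_lt_one_of_pos hu
    have h2 : 0 < u ^ (-lam - 1) := by positivity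
    nlinarith
  have h2 : 0 < ∫ u in Ioi (0 : ℝ), -(u ^ (-lam - 1) * (Real.exp (-u) - 1)) := by
    rw [setIntegral_pos_iff_support_of_nonneg_ae _ h]
    · have : Ioi (0 : ℝ) ⊆ Function.support
          (fun u : ℝ => -(u ^ (-lam - 1) * (Real.exp (-u) - 1))) ∩ Ioi 0 :=
        fun u hu => ⟨(hpos u hu).ne', hu⟩
      refine lt_of_lt_of_le ?_ (measure_mono this)
      simp
    · filter_upwards [ae_restrict_mem measurableSet_Ioi] with u hu
      exact (hpos u hu).le
  rw [integral_neg] at h2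
  unfold laguerreFracConst
  linarith

lemma integral_rpow_mul_exp_sub_one (hlam : 0 < lam) {m : ℝ} (hm : 0 ≤ m) :
    ∫ s in Ioi (0 : ℝ), s ^ (-lam - 1) * (Real.exp (-(s * m)) - 1)
      = m ^ lam * laguerreFracConst lam := by
  rcases hm.eq_or_lt with rfl | hm
  · simp [Real.zero_rpow hlam.ne']
  have h := integral_comp_mul_left_Ioi (fun u : ℝ => u ^ (-lam - 1) * (Real.exp (-u) - 1)) 0 hm
  rw [mul_zero, smul_eq_mul] at h
  have h2 : ∫ s in Ioi (0 : ℝ), (m * s) ^ (-lam - 1) * (Real.exp (-(m * s)) - 1)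
      = m ^ (-lam - 1) * ∫ s in Ioi (0 : ℝ), s ^ (-lam - 1) * (Real.exp (-(s * m)) - 1) := by
    rw [← integral_const_mul]
    refine setIntegral_congr_fun measurableSet_Ioi fun s hs => ?_
    have hs : 0 < s := hs
    rw [Real.mul_rpow hm.le hs.le, mul_comm m s]
    ring
  rw [h2] at h
  have h3 : m ^ (-lam - 1) * (m ^ lam * m) = 1 := by
    nth_rewrite 3 [← Real.rpow_one m]
    rw [← Real.rpow_add hm, ← Real.rpow_add hm]
    ring_nf
    simp
  unfold laguerreFracConst
  set I := ∫ s in Ioi (0 : ℝ), s ^ (-lam - 1) * (Real.exp (-(s * m)) - 1)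
  set J := ∫ u in Ioi (0 : ℝ), u ^ (-lam - 1) * (Real.exp (-u) - 1)
  calc I = (m ^ (-lam - 1) * I) * (m ^ lam * m) := by linear_combination (-I) * h3
    _ = _ := by rw [h]; field_simp

lemma sqrt_rpow_eq {n : ℝ} (hn : 0 ≤ n) : √n ^ lam = n ^ (lam / 2) := by
  rw [Real.sqrt_eq_rpow, ← Real.rpow_mul hn]
  congr 1
  ring

end Weight

/-! ### Integrals of families of bounded functions -/

section Families

variable {𝕜 : Type*} [RCLike 𝕜] {d : ℕ} {α : Fin d → ℝ} {F : ℝ → (Fin d → ℝ) → 𝕜} {b : ℝ → ℝ}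

/-- If `‖F s x‖ ≤ b s` for each `s` and almost every `x`, where `b` is integrable, then `∫ F s x ds`
converges absolutely for almost every `x`, is bounded by `∫ b`, and its Laguerre coefficients are
obtained under the integral sign. -/
lemma integral_family_of_bound (hα : ∀ i, -1 < α i)
    (hF : StronglyMeasurable fun p : ℝ × (Fin d → ℝ) => F p.1 p.2) (hbm : Measurable b)
    (hb : IntegrableOn b (Ioi 0))
    (hFb : ∀ s, 0 < s → ∀ᵐ x ∂(laguerreMeasure α), ‖F s x‖ ≤ b s) :
    (∀ᵐ x ∂(laguerreMeasure α), IntegrableOn (fun s => F s x) (Ioi 0)) ∧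
    (∀ᵐ x ∂(laguerreMeasure α), ‖∫ s in Ioi (0 : ℝ), F s x‖ ≤ ∫ s in Ioi (0 : ℝ), b s) ∧
    AEStronglyMeasurable (fun x => ∫ s in Ioi (0 : ℝ), F s x) (laguerreMeasure α) ∧
    ∀ k, laguerreCoeff α (fun x => ∫ s in Ioi (0 : ℝ), F s x) k
      = ∫ s in Ioi (0 : ℝ), laguerreCoeff α (F s) k := by
  set μ := laguerreMeasure α with hμ
  set ν : Measure ℝ := volume.restrict (Ioi (0 : ℝ)) with hν
  have hsw : StronglyMeasurable fun p : (Fin d → ℝ) × ℝ => F p.2 p.1 := by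
    have h := hF.comp_measurable measurable_swap
    exact h
  have hms : MeasurableSet {p : ℝ × (Fin d → ℝ) | ‖F p.1 p.2‖ ≤ b p.1} :=
    measurableSet_le hF.norm.measurable (hbm.comp measurable_fst)
  have hae : ∀ᵐ s ∂ν, ∀ᵐ x ∂μ, ‖F s x‖ ≤ b s := by
    filter_upwards [ae_restrict_mem measurableSet_Ioi] with s hs
    exact hFb s hs
  have hae' : ∀ᵐ x ∂μ, ∀ᵐ s ∂ν, ‖F s x‖ ≤ b s := (Measure.ae_ae_comm hms).1 hae
  refine ⟨?_, ?_, hsw.integral_prod_right'.aestronglyMeasurable, fun k => ?_⟩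
  · filter_upwards [hae'] with x hx
    have h := hF.comp_measurable (measurable_prodMk_right (y := x))
    exact Integrable.mono' hb h.aestronglyMeasurable hx
  · filter_upwards [hae'] with x hx
    exact norm_integral_le_of_norm_le hb hx
  · have hmeas : AEStronglyMeasurable (fun p : (Fin d → ℝ) × ℝ =>
        laguerrePolyPi α k p.1 • F p.2 p.1) (μ.prod ν) :=
      ((measurable_laguerrePolyPi k).comp measurable_fst).aestronglyMeasurable.smul
        hsw.aestronglyMeasurable
    have hint : Integrable (fun p : (Fin d → ℝ) × ℝ => laguerrePolyPi α k p.1 • F p.2 p.1)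
        (μ.prod ν) := by
      have h1 : Integrable (fun p : (Fin d → ℝ) × ℝ => ‖laguerrePolyPi α k p.1‖ * b p.2)
          (μ.prod ν) := (integrable_laguerrePolyPi hα k).norm.mul_prod hb
      refine h1.mono' hmeas ?_
      have hms' : MeasurableSet {p : (Fin d → ℝ) × ℝ | ‖F p.2 p.1‖ ≤ b p.2} :=
        measurableSet_le hsw.norm.measurable (hbm.comp measurable_snd)
      filter_upwards [(Measure.ae_prod_mem_iff_ae_ae_mem hms').2 hae'] with p hp
      rw [norm_smul]
      exact mul_le_mul_of_nonneg_left hp (norm_nonneg _)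
    simp only [laguerreCoeff, ← integral_smul]
    exact integral_integral_swap hint

end Families

/-! ### Lipschitz functions and the Poisson semigroup -/

section Lipschitz

variable {𝕜 : Type*} [RCLike 𝕜] {d : ℕ} {α : Fin d → ℝ} {f g : (Fin d → ℝ) → 𝕜} {M A β : ℝ}

lemma kernelHeat_congr_ae (h : f =ᵐ[laguerreMeasure α] g) : kernelHeat α f = kernelHeat α g := by
  ext t x
  refine integral_congr_ae ?_
  filter_upwards [h] with y hy
  rw [hy]

lemma poisson_congr_ae (h : f =ᵐ[laguerreMeasure α] g) : poisson α f = poisson α g := by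
  unfold poisson
  rw [kernelHeat_congr_ae h]

lemma ae_norm_le_toReal_eLpNorm (hf : MemLp f ∞ (laguerreMeasure α)) :
    ∀ᵐ x ∂(laguerreMeasure α), ‖f x‖ ≤ (eLpNorm f ∞ (laguerreMeasure α)).toReal := by
  have h := hf.2.ne
  rw [eLpNorm_exponent_top] at h ⊢
  filter_upwards [ae_le_eLpNormEssSup (f := f)] with x hx
  rw [← ENNReal.ofReal_le_iff_le_toReal h, ofReal_norm]
  exact hx

lemma eLpNorm_top_le_ofReal_iff {X : Type*} [MeasurableSpace X] {μ : Measure X} {u : X → 𝕜}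
    {c : ℝ} (hc : 0 ≤ c) : eLpNorm u ∞ μ ≤ ENNReal.ofReal c ↔ ∀ᵐ x ∂μ, ‖u x‖ ≤ c := by
  rw [eLpNorm_exponent_top]
  refine ⟨fun h => ?_, eLpNormEssSup_le_of_ae_bound⟩
  filter_upwards [ae_le_eLpNormEssSup (f := u) (μ := μ)] with x hx
  rw [← ENNReal.ofReal_le_ofReal_iff hc, ofReal_norm]
  exact hx.trans h

/-- For `β < 1` the Lipschitz condition involves only the first derivative of the Poisson
semigroup. -/
lemma mem_laguerreLipConstants_iff (hα : ∀ i, -1 < α i)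
    (hf : AEStronglyMeasurable f (laguerreMeasure α)) (hM : ∀ᵐ x ∂(laguerreMeasure α), ‖f x‖ ≤ M)
    (hβ1 : β < 1) :
    A ∈ laguerreLipConstants α β f ↔ 0 ≤ A ∧ ∀ t, 0 < t →
      ∀ᵐ x ∂(laguerreMeasure α), ‖poissonDeriv α f t x‖ ≤ A * t ^ (β - 1) := by
  have hfl : ⌊β⌋₊ = 0 := Nat.floor_eq_zero.2 hβ1
  simp only [laguerreLipConstants, mem_ofPred_eq, hfl]
  refine and_congr_right fun hA => forall₂_congr fun t ht => ?_
  have e : -((0 + 1 : ℕ) : ℝ) + β = β - 1 := by push_cast; ring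
  rw [e, eLpNorm_top_le_ofReal_iff (by positivity)]
  have hd : ∀ᵐ x ∂(laguerreMeasure α), iteratedDeriv (0 + 1) (fun s => laguerrePoisson α s f x) t
      = poissonDeriv α f t x := by
    filter_upwards [ae_pos_laguerreMeasure α] with x hx
    rw [zero_add, iteratedDeriv_one]
    exact (hasDerivAt_laguerrePoisson hα hf hM ht hx).deriv
  constructor
  · intro h
    filter_upwards [h, hd] with x h1 h2
    rwa [← h2]
  · intro h
    filter_upwards [h, hd] with x h1 h2
    rwa [h2]

/-- A Lipschitz function is approximated by its Poisson integrals with rate `s ^ β`. The bound on the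
derivative shows that the Poisson integrals converge uniformly as `s → 0`, and the limit is `f`
because it has the same Laguerre coefficients. -/
lemma norm_poisson_sub_le (hα : ∀ i, -1 < α i)
    (hf : AEStronglyMeasurable f (laguerreMeasure α)) (hM : ∀ᵐ x ∂(laguerreMeasure α), ‖f x‖ ≤ M)
    (hβ : 0 < β) (hA : 0 ≤ A)
    (hQ : ∀ t, 0 < t → ∀ᵐ x ∂(laguerreMeasure α), ‖poissonDeriv α f t x‖ ≤ A * t ^ (β - 1))
    {s : ℝ} (hs : 0 < s) :
    ∀ᵐ x ∂(laguerreMeasure α), ‖poisson α f s x - f x‖ ≤ A / β * s ^ β := by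
  set μ := laguerreMeasure α with hμ
  have hms : MeasurableSet {p : ℝ × (Fin d → ℝ) | ‖poissonDeriv α f p.1 p.2‖ ≤ A * p.1 ^ (β - 1)} :=
    measurableSet_le (stronglyMeasurable_poissonDeriv hα hf).norm.measurable (by fun_prop)
  have hae : ∀ᵐ s ∂(volume.restrict (Ioi (0 : ℝ))), ∀ᵐ x ∂μ,
      ‖poissonDeriv α f s x‖ ≤ A * s ^ (β - 1) := by
    filter_upwards [ae_restrict_mem measurableSet_Ioi] with t ht
    exact hQ t ht
  have hH : ∀ᵐ x ∂μ, ∀ r t : ℝ, 0 < r → r ≤ t →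
      ‖poisson α f t x - poisson α f r x‖ ≤ A / β * t ^ β := by
    filter_upwards [(Measure.ae_ae_comm hms).1 hae, ae_pos_laguerreMeasure α]
      with x hx hx0 r t hr hrt
    exact norm_subordinate_sub_le_rpow (aestronglyMeasurable_kernelHeat_section hα hf x)
      (norm_kernelHeat_section_le hα hM hx0) hA hβ hx hr hrt
  -- Along `ε n → 0` the Poisson integrals form a Cauchy sequence at almost every point.
  set ε : ℕ → ℝ := fun n => 1 / ((n : ℝ) + 1) with hε
  have hε0 : ∀ n, 0 < ε n := fun n => by positivity
  have hεanti : ∀ m n, m ≤ n → ε n ≤ ε m := fun m n h => one_div_le_one_div_of_le (by positivity)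
    (by have : (m : ℝ) ≤ n := by exact_mod_cast h
        linarith)
  have hεlim : Filter.Tendsto ε Filter.atTop (nhds 0) := tendsto_one_div_add_atTop_nhds_zero_nat
  have hlim : ∀ᵐ x ∂μ, ∃ l,
      Filter.Tendsto (fun n => poisson α f (ε n) x) Filter.atTop (nhds l) := by
    filter_upwards [hH] with x hx
    refine cauchySeq_tendsto_of_complete
      (cauchySeq_of_le_tendsto_0' (fun n => A / β * ε n ^ β) (fun n m hnm => ?_) ?_)
    · rw [dist_eq_norm]
      exact hx _ _ (hε0 m) (hεanti n m hnm)
    · have := (hεlim.rpow_const (p := β) (Or.inr hβ.le)).const_mul (A / β)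
      rwa [Real.zero_rpow hβ.ne', mul_zero] at this
  obtain ⟨l, hlm, hl⟩ := exists_stronglyMeasurable_limit_of_tendsto_ae
    (fun n => (stronglyMeasurable_poisson_right hα hf (ε n)).aestronglyMeasurable) hlim
  have hPM : ∀ᵐ x ∂μ, ∀ n, ‖poisson α f (ε n) x‖ ≤ M := by
    filter_upwards [ae_pos_laguerreMeasure α] with x hx n
    exact norm_poisson_le hα hM (hε0 n) hx
  have hlM : ∀ᵐ x ∂μ, ‖l x‖ ≤ M := by
    filter_upwards [hl, hPM] with x hx hxM
    exact le_of_tendsto hx.norm (Filter.Eventually.of_forall hxM)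
  have hlf : l =ᵐ[μ] f := by
    refine ae_eq_of_laguerreCoeff_eq hα hlm.aestronglyMeasurable hlM hf hM fun k => ?_
    have h1 : Filter.Tendsto (fun n => laguerreCoeff α (poisson α f (ε n)) k) Filter.atTop
        (nhds (laguerreCoeff α l k)) := by
      refine tendsto_integral_of_dominated_convergence (fun x => ‖laguerrePolyPi α k x‖ * M)
        (fun n => ?_) ((integrable_laguerrePolyPi hα k).norm.mul_const M) (fun n => ?_) ?_
      · exact (measurable_laguerrePolyPi k).aestronglyMeasurable.smul
          (stronglyMeasurable_poisson_right hα hf (ε n)).aestronglyMeasurable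
      · filter_upwards [hPM] with x hx
        rw [norm_smul]
        exact mul_le_mul_of_nonneg_left (hx n) (norm_nonneg _)
      · filter_upwards [hl] with x hx
        exact hx.const_smul _
    have h2 : Filter.Tendsto (fun n => laguerreCoeff α (poisson α f (ε n)) k) Filter.atTop
        (nhds (laguerreCoeff α f k)) := by
      simp_rw [fun n => laguerreCoeff_poisson hα hf hM (hε0 n) k]
      have hc : Continuous fun r : ℝ =>
          Real.exp (-(r * √((∑ i, k i : ℕ) : ℝ))) • laguerreCoeff α f k := by fun_prop
      have h3 := (hc.tendsto 0).comp hεlim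
      simp only [zero_mul, neg_zero, Real.exp_zero, one_smul] at h3
      exact h3
    exact tendsto_nhds_unique h1 h2
  filter_upwards [hH, hl, hlf] with x hx hlx hlfx
  rw [hlfx] at hlx
  refine le_of_tendsto (tendsto_const_nhds.sub hlx).norm ?_
  filter_upwards [hεlim.eventually (gt_mem_nhds hs)] with n hn
  exact hx _ _ (hε0 n) hn.le

/-- The semigroup law for the derivative of the Poisson semigroup. -/
lemma poissonDeriv_add (hα : ∀ i, -1 < α i)
    (hf : AEStronglyMeasurable f (laguerreMeasure α)) (hM : ∀ᵐ x ∂(laguerreMeasure α), ‖f x‖ ≤ M)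
    {r t : ℝ} (hr : 0 < r) (ht : 0 < t) :
    poissonDeriv α f (r + t) =ᵐ[laguerreMeasure α] poisson α (poissonDeriv α f t) r := by
  have hQm := (stronglyMeasurable_poissonDeriv_right hα hf t).aestronglyMeasurable
    (μ := laguerreMeasure α)
  have hQ : ∀ᵐ x ∂(laguerreMeasure α), ‖poissonDeriv α f t x‖ ≤ 2 * M / t := by
    filter_upwards [ae_pos_laguerreMeasure α] with x hx
    exact norm_poissonDeriv_le hα hM ht hx
  have hQ' : ∀ᵐ x ∂(laguerreMeasure α), ‖poissonDeriv α f (r + t) x‖ ≤ 2 * M / (r + t) := by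
    filter_upwards [ae_pos_laguerreMeasure α] with x hx
    exact norm_poissonDeriv_le hα hM (by positivity) hx
  have hP : ∀ᵐ x ∂(laguerreMeasure α), ‖poisson α (poissonDeriv α f t) r x‖ ≤ 2 * M / t := by
    filter_upwards [ae_pos_laguerreMeasure α] with x hx
    exact norm_poisson_le hα hQ hr hx
  refine ae_eq_of_laguerreCoeff_eq hα
    (stronglyMeasurable_poissonDeriv_right hα hf (r + t)).aestronglyMeasurable hQ'
    (stronglyMeasurable_poisson_right hα hQm r).aestronglyMeasurable hP fun k => ?_
  rw [laguerreCoeff_poissonDeriv hα hf hM (by positivity), laguerreCoeff_poisson hα hQm hQ hr,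
    laguerreCoeff_poissonDeriv hα hf hM ht, smul_smul]
  congr 1
  rw [mul_left_comm, ← Real.exp_add]
  congr 2
  ring

/-- The increments of the derivative of the Poisson semigroup of a Lipschitz function. For small
increments `s` the bound comes from writing `∂_t P_{t+s} f - ∂_t P_t f` as
`(P_{t/2+s} - P_{t/2})` applied to `∂_t P_{t/2} f`. -/
lemma norm_poissonDeriv_add_sub_le (hα : ∀ i, -1 < α i)
    (hf : AEStronglyMeasurable f (laguerreMeasure α)) (hM : ∀ᵐ x ∂(laguerreMeasure α), ‖f x‖ ≤ M)
    (hβ : 0 < β) (hβ1 : β < 1) (hA : 0 ≤ A)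
    (hQ : ∀ t, 0 < t → ∀ᵐ x ∂(laguerreMeasure α), ‖poissonDeriv α f t x‖ ≤ A * t ^ (β - 1))
    {s t : ℝ} (hs : 0 < s) (ht : 0 < t) :
    ∀ᵐ x ∂(laguerreMeasure α), ‖poissonDeriv α f (t + s) x - poissonDeriv α f t x‖
      ≤ if s ≤ t then 8 * A * t ^ (β - 2) * s ^ (1 : ℝ) else 2 * A * t ^ (β - 1) := by
  split_ifs with hst
  · have ht2 : 0 < t / 2 := by positivity
    have hQm := (stronglyMeasurable_poissonDeriv_right hα hf (t / 2)).aestronglyMeasurable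
      (μ := laguerreMeasure α)
    have e1 := poissonDeriv_add hα hf hM (r := t / 2 + s) (by positivity) ht2
    have e2 := poissonDeriv_add hα hf hM ht2 ht2
    have hN : A * (t / 2) ^ (β - 1) ≤ 2 * A * t ^ (β - 1) := by
      have h2 : (t / 2) ^ (β - 1) = t ^ (β - 1) * 2 ^ (1 - β) := by
        rw [Real.div_rpow ht.le (by norm_num), div_eq_mul_inv, ← Real.rpow_neg (by norm_num)]
        ring_nf
      have h3 : (2 : ℝ) ^ (1 - β) ≤ 2 := by
        calc (2 : ℝ) ^ (1 - β) ≤ 2 ^ (1 : ℝ) :=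
              Real.rpow_le_rpow_of_exponent_le (by norm_num) (by linarith)
          _ = 2 := Real.rpow_one 2
      rw [h2]
      calc A * (t ^ (β - 1) * 2 ^ (1 - β)) ≤ A * (t ^ (β - 1) * 2) := by gcongr
        _ = _ := by ring
    filter_upwards [e1, e2, ae_pos_laguerreMeasure α] with x h1 h2 hx
    rw [add_halves] at h2
    rw [show t + s = t / 2 + s + t / 2 by ring, h1, h2]
    have h3 := norm_subordinate_sub_le
      (aestronglyMeasurable_kernelHeat_section hα hQm x)
      (norm_kernelHeat_section_le hα (hQ _ ht2) hx) ht2 (by linarith : t / 2 ≤ t / 2 + s)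
    refine h3.trans ?_
    rw [add_sub_cancel_left, Real.rpow_one]
    have h4 : t ^ (β - 2) = t ^ (β - 1) / t := by
      rw [← Real.rpow_sub_one ht.ne']; ring_nf
    calc 2 * (A * (t / 2) ^ (β - 1)) / (t / 2) * s
        ≤ 2 * (2 * A * t ^ (β - 1)) / (t / 2) * s := by gcongr
      _ = 8 * A * t ^ (β - 2) * s := by rw [h4]; field_simp; ring
  · filter_upwards [hQ (t + s) (by positivity), hQ t ht] with x h1 h2
    have h3 : (t + s) ^ (β - 1) ≤ t ^ (β - 1) :=
      Real.rpow_le_rpow_of_nonpos ht (by linarith) (by linarith)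
    calc _ ≤ A * (t + s) ^ (β - 1) + A * t ^ (β - 1) := (norm_sub_le _ _).trans (add_le_add h1 h2)
      _ ≤ A * t ^ (β - 1) + A * t ^ (β - 1) := by gcongr
      _ = _ := by ring

/-! ### The fractional derivative -/

variable {lam : ℝ}

/-- The integrand of the fractional derivative, written with `poisson`. -/
noncomputable def fracIntegrand (α : Fin d → ℝ) (lam : ℝ) (f : (Fin d → ℝ) → 𝕜) (s : ℝ)
    (x : Fin d → ℝ) : 𝕜 :=
  s ^ (-lam - 1) • (poisson α f s x - f x)

/-- Absolute convergence, boundedness and Laguerre coefficients of the integral that defines the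
fractional derivative, for a strongly measurable representative. -/
lemma integral_fracIntegrand (hα : ∀ i, -1 < α i) (hf : StronglyMeasurable f)
    (hM : ∀ᵐ x ∂(laguerreMeasure α), ‖f x‖ ≤ M)
    (hlam : 0 < lam) (hlamβ : lam < β) (hA : 0 ≤ A)
    (hQ : ∀ t, 0 < t → ∀ᵐ x ∂(laguerreMeasure α), ‖poissonDeriv α f t x‖ ≤ A * t ^ (β - 1)) :
    (∀ᵐ x ∂(laguerreMeasure α), IntegrableOn (fun s => fracIntegrand α lam f s x) (Ioi 0)) ∧
    (∀ᵐ x ∂(laguerreMeasure α), ‖∫ s in Ioi (0 : ℝ), fracIntegrand α lam f s x‖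
      ≤ A / β / (β - lam) + 2 * M / lam) ∧
    AEStronglyMeasurable (fun x => ∫ s in Ioi (0 : ℝ), fracIntegrand α lam f s x)
      (laguerreMeasure α) ∧
    ∀ k, laguerreCoeff α (fun x => ∫ s in Ioi (0 : ℝ), fracIntegrand α lam f s x) k
      = ((((∑ i, k i : ℕ) : ℝ) ^ (lam / 2)) * laguerreFracConst lam) • laguerreCoeff α f k := by
  have hβ : 0 < β := hlam.trans hlamβ
  have hfm : AEStronglyMeasurable f (laguerreMeasure α) := hf.aestronglyMeasurable
  have hb := fracMajorant_integrableOn_and_integral (a := A / β) (c := 2 * M) hlam hlamβ one_pos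
  simp only [Real.one_rpow, mul_one] at hb
  have hF : StronglyMeasurable fun p : ℝ × (Fin d → ℝ) => fracIntegrand α lam f p.1 p.2 := by
    have h1 : Measurable fun p : ℝ × (Fin d → ℝ) => p.1 ^ (-lam - 1) := by fun_prop
    exact h1.stronglyMeasurable.smul
      ((stronglyMeasurable_poisson hα hfm).sub (hf.comp_measurable measurable_snd))
  have hFb : ∀ s, 0 < s → ∀ᵐ x ∂(laguerreMeasure α), ‖fracIntegrand α lam f s x‖
      ≤ fracMajorant lam β (A / β) (2 * M) 1 s := by
    intro s hs
    filter_upwards [norm_poisson_sub_le hα hfm hM hβ hA hQ hs, hM, ae_pos_laguerreMeasure α]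
      with x hx1 hx2 hx3
    have hs' : 0 < s ^ (-lam - 1) := by positivity
    rw [fracIntegrand, norm_smul, Real.norm_of_nonneg hs'.le, fracMajorant]
    refine mul_le_mul_of_nonneg_left ?_ hs'.le
    split_ifs
    · exact hx1
    · calc _ ≤ M + M := (norm_sub_le _ _).trans (add_le_add (norm_poisson_le hα hM hs hx3) hx2)
        _ = _ := by ring
  obtain ⟨h1, h2, h3, h4⟩ := integral_family_of_bound hα hF measurable_fracMajorant hb.1 hFb
  rw [hb.2] at h2
  refine ⟨h1, h2, h3, fun k => ?_⟩
  rw [h4 k, ← sqrt_rpow_eq (Nat.cast_nonneg _),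
    ← integral_rpow_mul_exp_sub_one hlam (Real.sqrt_nonneg _), ← integral_smul_const]
  refine setIntegral_congr_fun measurableSet_Ioi fun s hs => ?_
  have i1 := integrable_smul_of_bounded (integrable_laguerrePolyPi hα k) hfm hM
  have i2 := integrable_smul_of_bounded (M := M) (integrable_laguerrePolyPi hα k)
    (stronglyMeasurable_poisson_right hα hfm s).aestronglyMeasurable (by
      filter_upwards [ae_pos_laguerreMeasure α] with x hx
      exact norm_poisson_le hα hM hs hx)
  have e : ∀ x, laguerrePolyPi α k x • fracIntegrand α lam f s x = s ^ (-lam - 1) •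
      (laguerrePolyPi α k x • poisson α f s x - laguerrePolyPi α k x • f x) := fun x => by
    rw [fracIntegrand, smul_comm, smul_sub (laguerrePolyPi α k x)]
  have h5 := laguerreCoeff_poisson hα hfm hM hs k
  simp only [laguerreCoeff] at h5 ⊢
  simp_rw [e]
  rw [integral_smul, integral_sub i2 i1, h5, mul_smul, sub_smul, one_smul]

/-- A bounded function `g` with the Laguerre coefficients of `L^{λ/2} f` is Lipschitz of order
`β - λ`. Indeed `∂_t P_t g` has the same coefficients as
`(1 / c_λ) ∫ s ^ (-λ - 1) (∂_t P_{t+s} f - ∂_t P_t f) ds`. -/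
lemma norm_poissonDeriv_le_of_laguerreCoeff (hα : ∀ i, -1 < α i)
    (hf : AEStronglyMeasurable f (laguerreMeasure α)) (hM : ∀ᵐ x ∂(laguerreMeasure α), ‖f x‖ ≤ M)
    {N : ℝ} (hg : AEStronglyMeasurable g (laguerreMeasure α))
    (hN : ∀ᵐ x ∂(laguerreMeasure α), ‖g x‖ ≤ N)
    (hlam : 0 < lam) (hlamβ : lam < β) (hβ1 : β < 1) (hA : 0 ≤ A)
    (hQ : ∀ t, 0 < t → ∀ᵐ x ∂(laguerreMeasure α), ‖poissonDeriv α f t x‖ ≤ A * t ^ (β - 1))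
    (hfg : ∀ k, laguerreCoeff α g k = (((∑ i, k i : ℕ) : ℝ) ^ (lam / 2)) • laguerreCoeff α f k)
    {t : ℝ} (ht : 0 < t) :
    ∀ᵐ x ∂(laguerreMeasure α), ‖poissonDeriv α g t x‖
      ≤ |1 / laguerreFracConst lam| * (8 / (1 - lam) + 2 / lam) * A * t ^ (β - lam - 1) := by
  have hβ : 0 < β := hlam.trans hlamβ
  have hlam1 : lam < 1 := hlamβ.trans hβ1
  have hc := (laguerreFracConst_neg hlam hlam1).ne
  set F : ℝ → (Fin d → ℝ) → 𝕜 := fun s x =>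
    s ^ (-lam - 1) • (poissonDeriv α f (t + s) x - poissonDeriv α f t x) with hFdef
  have hb := fracMajorant_integrableOn_and_integral (a := 8 * A * t ^ (β - 2))
    (c := 2 * A * t ^ (β - 1)) hlam hlam1 ht
  have hF : StronglyMeasurable fun p : ℝ × (Fin d → ℝ) => F p.1 p.2 := by
    have h1 : Measurable fun p : ℝ × (Fin d → ℝ) => p.1 ^ (-lam - 1) := by fun_prop
    have h2 : Measurable fun p : ℝ × (Fin d → ℝ) => (t + p.1, p.2) := by fun_prop
    have h3 := (stronglyMeasurable_poissonDeriv hα hf).comp_measurable h2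
    have h5 : Measurable fun p : ℝ × (Fin d → ℝ) => p.2 := measurable_snd
    have h4 := (stronglyMeasurable_poissonDeriv_right hα hf t).comp_measurable h5
    exact h1.stronglyMeasurable.smul (h3.sub h4)
  have hFb : ∀ s, 0 < s → ∀ᵐ x ∂(laguerreMeasure α), ‖F s x‖
      ≤ fracMajorant lam 1 (8 * A * t ^ (β - 2)) (2 * A * t ^ (β - 1)) t s := by
    intro s hs
    filter_upwards [norm_poissonDeriv_add_sub_le hα hf hM hβ hβ1 hA hQ hs ht] with x hx
    have hs' : 0 < s ^ (-lam - 1) := by positivity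
    rw [hFdef]
    simp only
    rw [norm_smul, Real.norm_of_nonneg hs'.le, fracMajorant]
    exact mul_le_mul_of_nonneg_left hx hs'.le
  obtain ⟨-, h2, h3, h4⟩ := integral_family_of_bound hα hF measurable_fracMajorant hb.1 hFb
  set B : ℝ := ∫ s in Ioi (0 : ℝ),
    fracMajorant lam 1 (8 * A * t ^ (β - 2)) (2 * A * t ^ (β - 1)) t s
  have hBle : ∀ᵐ x ∂(laguerreMeasure α),
      ‖(1 / laguerreFracConst lam) • ∫ s in Ioi (0 : ℝ), F s x‖
        ≤ |1 / laguerreFracConst lam| * B := by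
    filter_upwards [h2] with x hx
    rw [norm_smul, Real.norm_eq_abs]
    exact mul_le_mul_of_nonneg_left hx (abs_nonneg _)
  have heq : poissonDeriv α g t =ᵐ[laguerreMeasure α]
      fun x => (1 / laguerreFracConst lam) • ∫ s in Ioi (0 : ℝ), F s x := by
    refine ae_eq_of_laguerreCoeff_eq hα (M := 2 * N / t)
      (stronglyMeasurable_poissonDeriv_right hα hg t).aestronglyMeasurable ?_
      (h3.const_smul (1 / laguerreFracConst lam)) hBle fun k => ?_
    · filter_upwards [ae_pos_laguerreMeasure α] with x hx
      exact norm_poissonDeriv_le hα hN ht hx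
    -- Both sides have the coefficient `-m e^{-t m} m ^ λ` times that of `f`, where `m = √|k|`.
    · set m : ℝ := √((∑ i, k i : ℕ) : ℝ) with hm
      have hint : ∀ r, 0 < r → Integrable (fun x => laguerrePolyPi α k x • poissonDeriv α f r x)
          (laguerreMeasure α) := fun r hr =>
        integrable_smul_of_bounded (M := 2 * M / r) (integrable_laguerrePolyPi hα k)
          (stronglyMeasurable_poissonDeriv_right hα hf r).aestronglyMeasurable (by
            filter_upwards [ae_pos_laguerreMeasure α] with x hx
            exact norm_poissonDeriv_le hα hM hr hx)
      have hcoef : ∀ s, 0 < s → laguerreCoeff α (F s) k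
          = (s ^ (-lam - 1) * (Real.exp (-(s * m)) - 1)) •
            ((-m * Real.exp (-(t * m))) • laguerreCoeff α f k) := by
        intro s hs
        have e : ∀ x, laguerrePolyPi α k x • F s x = s ^ (-lam - 1) •
            (laguerrePolyPi α k x • poissonDeriv α f (t + s) x
              - laguerrePolyPi α k x • poissonDeriv α f t x) := fun x => by
          rw [hFdef]
          simp only
          rw [smul_comm, smul_sub (laguerrePolyPi α k x)]
        have e1 := laguerreCoeff_poissonDeriv hα hf hM (s := t + s) (by positivity) k
        have e2 := laguerreCoeff_poissonDeriv hα hf hM ht k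
        have e3 : Real.exp (-((t + s) * m)) = Real.exp (-(t * m)) * Real.exp (-(s * m)) := by
          rw [← Real.exp_add]; ring_nf
        simp only [laguerreCoeff] at e1 e2 ⊢
        simp_rw [e]
        rw [integral_smul, integral_sub (hint _ (by positivity)) (hint _ ht), e1, e2, ← sub_smul,
          smul_smul, smul_smul, ← hm, e3]
        congr 1
        ring
      have hconst : laguerreCoeff α
          (fun x => (1 / laguerreFracConst lam) • ∫ s in Ioi (0 : ℝ), F s x) k
          = (1 / laguerreFracConst lam) •
            laguerreCoeff α (fun x => ∫ s in Ioi (0 : ℝ), F s x) k := by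
        simp only [laguerreCoeff]
        rw [← integral_smul]
        exact integral_congr_ae (Filter.Eventually.of_forall fun x => smul_comm _ _ _)
      rw [hconst, h4 k, setIntegral_congr_fun measurableSet_Ioi fun s hs => hcoef s hs,
        integral_smul_const, integral_rpow_mul_exp_sub_one hlam (Real.sqrt_nonneg _),
        laguerreCoeff_poissonDeriv hα hg hN ht, hfg k, smul_smul, smul_smul, smul_smul, ← hm,
        hm, sqrt_rpow_eq (Nat.cast_nonneg _), ← hm]
      congr 1
      field_simp
  filter_upwards [heq, hBle] with x hx1 hx2
  rw [hx1]
  refine hx2.trans_eq ?_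
  rw [hb.2]
  have p1 : t ^ (β - 2) * t ^ (1 - lam) = t ^ (β - lam - 1) := by
    rw [← Real.rpow_add ht]; ring_nf
  have p2 : t ^ (β - 1) * t ^ (-lam) = t ^ (β - lam - 1) := by
    rw [← Real.rpow_add ht]; ring_nf
  calc _ = |1 / laguerreFracConst lam| * (8 * A * (t ^ (β - 2) * t ^ (1 - lam)) / (1 - lam)
        + 2 * A * (t ^ (β - 1) * t ^ (-lam)) / lam) := by ring
    _ = _ := by rw [p1, p2]; ring

/-- The fractional derivative, up to a null set, in terms of a strongly measurable
representative. -/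
lemma laguerreFracDeriv_ae_eq (h : f =ᵐ[laguerreMeasure α] g) :
    ∀ᵐ x ∂(laguerreMeasure α), EqOn (fun s => s ^ (-lam - 1) • (laguerrePoisson α s f x - f x))
      (fun s => fracIntegrand α lam g s x) (Ioi 0) := by
  filter_upwards [h, ae_pos_laguerreMeasure α] with x hx hx0 s hs
  simp only [fracIntegrand]
  rw [laguerrePoisson_eq_poisson hs f hx0, poisson_congr_ae h, hx]

end Lipschitz

theorem theorem4p2 {𝕜 : Type*} [RCLike 𝕜] {d : ℕ} (α : Fin d → ℝ) (hα : ∀ i, -1 / 2 < α i)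
    (lam β : ℝ) (hlam : 0 < lam) (hlamβ : lam < β) (hβ : β < 1) :
    ∃ C : ℝ, 0 < C ∧ ∀ f : (Fin d → ℝ) → 𝕜, MemLaguerreLip α β f →
      (∀ᵐ x ∂(laguerreMeasure α),
        IntegrableOn (fun s : ℝ => s ^ (-lam - 1) • (laguerrePoisson α s f x - f x))
          (Ioi (0 : ℝ))) ∧
      IsLaguerrePower α (lam / 2) f (laguerreFracDeriv α lam f) ∧
      MemLaguerreLip α (β - lam) (laguerreFracDeriv α lam f) ∧
      laguerreLipNorm α (β - lam) (laguerreFracDeriv α lam f) ≤ C * laguerreLipNorm α β f := by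
  have hα' : ∀ i, -1 < α i := fun i => by linarith [hα i]
  have := isProbabilityMeasure_laguerreMeasure hα'
  have hβ0 : 0 < β := hlam.trans hlamβ
  have hlam1 : lam < 1 := hlamβ.trans hβ
  have hβlam : 0 < β - lam := by linarith
  have h1lam : 0 < 1 - lam := by linarith
  have hc := (laguerreFracConst_neg hlam hlam1).ne
  have hc0 : 0 < |1 / laguerreFracConst lam| := abs_pos.2 (one_div_ne_zero hc)
  set q : ℝ := |1 / laguerreFracConst lam| with hq
  set K₁ : ℝ := q * (8 / (1 - lam) + 2 / lam) with hK₁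
  set K₂ : ℝ := q * (1 / β / (β - lam) + 2 / lam) with hK₂
  have hK₁0 : 0 < K₁ := by positivity
  have hK₂0 : 0 < K₂ := by positivity
  refine ⟨K₁ + K₂, by positivity, fun f hf => ?_⟩
  obtain ⟨hfL, hfA⟩ := hf
  set M : ℝ := (eLpNorm f ∞ (laguerreMeasure α)).toReal with hMdef
  have hM : ∀ᵐ x ∂(laguerreMeasure α), ‖f x‖ ≤ M := ae_norm_le_toReal_eLpNorm hfL
  have hM0 : 0 ≤ M := ENNReal.toReal_nonneg
  have hfm := hfL.1
  -- The Poisson integrals for `s > 0` do not change when `f` is modified on a null set, so the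
  -- integrand may be studied for a strongly measurable representative of `f`.
  set f₀ := hfm.mk f with hf₀
  have hff₀ : f =ᵐ[laguerreMeasure α] f₀ := hfm.ae_eq_mk
  have hf₀m : StronglyMeasurable f₀ := hfm.stronglyMeasurable_mk
  have hM₀ : ∀ᵐ x ∂(laguerreMeasure α), ‖f₀ x‖ ≤ M := by
    filter_upwards [hM, hff₀] with x h1 h2
    rwa [← h2]
  set g := laguerreFracDeriv α lam f with hg
  have hgae : g =ᵐ[laguerreMeasure α] fun x =>
      (1 / laguerreFracConst lam) • ∫ s in Ioi (0 : ℝ), fracIntegrand α lam f₀ s x := by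
    filter_upwards [laguerreFracDeriv_ae_eq (lam := lam) hff₀] with x hx
    simp only [hg, laguerreFracDeriv]
    rw [setIntegral_congr_fun measurableSet_Ioi hx]
  have hQ : ∀ A ∈ laguerreLipConstants α β f, 0 ≤ A ∧ ∀ t, 0 < t →
      ∀ᵐ x ∂(laguerreMeasure α), ‖poissonDeriv α f₀ t x‖ ≤ A * t ^ (β - 1) := by
    intro A hA
    have h := (mem_laguerreLipConstants_iff hα' hfm hM hβ).1 hA
    unfold poissonDeriv at h ⊢
    rwa [kernelHeat_congr_ae hff₀] at h
  have hmain := fun A hA => integral_fracIntegrand hα' hf₀m hM₀ hlam hlamβ (hQ A hA).1 (hQ A hA).2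
  obtain ⟨A₀, hA₀⟩ := hfA
  have hgm : AEStronglyMeasurable g (laguerreMeasure α) :=
    ((hmain A₀ hA₀).2.2.1.const_smul (1 / laguerreFracConst lam)).congr hgae.symm
  have hgb : ∀ A ∈ laguerreLipConstants α β f,
      ∀ᵐ x ∂(laguerreMeasure α), ‖g x‖ ≤ K₂ * (M + A) := by
    intro A hA
    filter_upwards [hgae, (hmain A hA).2.1] with x h1 h2
    have hA0 := (hQ A hA).1
    rw [h1, norm_smul, Real.norm_eq_abs, ← hq, hK₂, mul_assoc]
    refine mul_le_mul_of_nonneg_left (h2.trans ?_) hc0.le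
    have e1 : 0 ≤ 1 / β / (β - lam) * M := by positivity
    have e2 : 0 ≤ 2 / lam * A := by positivity
    calc A / β / (β - lam) + 2 * M / lam
        ≤ A / β / (β - lam) + 2 * M / lam + 1 / β / (β - lam) * M + 2 / lam * A := by linarith
      _ = _ := by ring
  have hgcoef : ∀ k, laguerreCoeff α g k
      = (((∑ i, k i : ℕ) : ℝ) ^ (lam / 2)) • laguerreCoeff α f k := by
    intro k
    rw [laguerreCoeff_congr_ae hgae, laguerreCoeff_congr_ae hff₀]
    have h := (hmain A₀ hA₀).2.2.2 k
    simp only [laguerreCoeff] at h ⊢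
    simp_rw [smul_comm (laguerrePolyPi α k _) (1 / laguerreFracConst lam)]
    rw [integral_smul, h, smul_smul]
    congr 1
    field_simp
  have hgA : ∀ A ∈ laguerreLipConstants α β f, K₁ * A ∈ laguerreLipConstants α (β - lam) g := by
    intro A hA
    have hA' := (mem_laguerreLipConstants_iff hα' hfm hM hβ).1 hA
    refine (mem_laguerreLipConstants_iff hα' hgm (hgb A₀ hA₀) (by linarith)).2
      ⟨mul_nonneg hK₁0.le hA'.1, fun t ht => ?_⟩
    exact norm_poissonDeriv_le_of_laguerreCoeff hα' hfm hM hgm (hgb A₀ hA₀) hlam hlamβ hβ hA'.1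
      hA'.2 hgcoef ht
  have hgL : MemLp g ∞ (laguerreMeasure α) := memLp_top_of_bound hgm _ (hgb A₀ hA₀)
  refine ⟨?_, ⟨hfL.mono_exponent le_top, hgL.mono_exponent le_top, hgcoef⟩,
    ⟨hgL, ⟨_, hgA A₀ hA₀⟩⟩, ?_⟩
  · filter_upwards [laguerreFracDeriv_ae_eq (lam := lam) hff₀, (hmain A₀ hA₀).1] with x h1 h2
    exact h2.congr_fun h1.symm measurableSet_Ioi
  · have hbound : ∀ A ∈ laguerreLipConstants α β f,
        laguerreLipNorm α (β - lam) g ≤ (K₁ + K₂) * (M + A) := by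
      intro A hA
      have hA0 := (hQ A hA).1
      have h1 : (eLpNorm g ∞ (laguerreMeasure α)).toReal ≤ K₂ * (M + A) :=
        ENNReal.toReal_le_of_le_ofReal (by positivity)
          ((eLpNorm_top_le_ofReal_iff (by positivity)).2 (hgb A hA))
      have h2 : sInf (laguerreLipConstants α (β - lam) g) ≤ K₁ * A :=
        csInf_le ⟨0, fun B hB => hB.1⟩ (hgA A hA)
      have h3 : 0 ≤ K₁ * M := by positivity
      unfold laguerreLipNorm
      linarith
    -- The bound holds for every admissible constant `A` of `f`, hence for their infimum.
    have h4 : laguerreLipNorm α (β - lam) g / (K₁ + K₂) - M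
        ≤ sInf (laguerreLipConstants α β f) := by
      refine le_csInf ⟨A₀, hA₀⟩ fun A hA => ?_
      rw [sub_le_iff_le_add, div_le_iff₀ (by positivity)]
      linarith [hbound A hA]
    rw [sub_le_iff_le_add, div_le_iff₀ (by positivity)] at h4
    unfold laguerreLipNorm at h4 ⊢
    linarith
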